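/- **Zhu recursion formula.** Let $(V,Y,\mathbf 1,\omega)$ be an $\mathbb R$-graded vertex operator superalgebra of central charge $c$: $V=V_{\bar0}\oplus V_{\bar1}=\bigoplus_{r\ge r_0}V_r$ with countably many non-zero $V_r$, $V_r$ being the eigenspace of $L(0)$ for $r\in\mathbb R$, with modes $Y(a,x)=\sum_{n\in\mathbb Z}a(n)x^{-n-1}$. Let $g$ be an automorphism of $V$ that commutes with the parity automorphism $\sigma$. Let $M$ be a $V$-module on which $\sigma$ and $g$ act compatibly with $Y_M$ and commute, and which is the direct sum of finite-dimensional $L(0)$-eigenspaces $M_h$ ($h\in\mathbb C$), such that for each $h$ one has $M_{h+x}=0$ for all sufficiently negative real $x$. For $u_1,\dots,u_n\in V$, $q_i=e^{z_i}$, $q=e^{2\pi i\tau}$, $\tau$ in the upper half plane, put $$F_M(g;u_1,\dots,u_n;\tau)=\mathrm{STr}_M\bigl(g\,Y_M(q_1^{L(0)}u_1,q_1)\cdots Y_M(q_n^{L(0)}u_n,q_n)\,q^{L(0)-c/24}\bigr),\qquad \mathrm{STr}_M(X)=\mathrm{Tr}_M(\sigma X),$$ a series in real powers of the $q_i$ and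 complex powers of $q$. For $v\in V$ homogeneous of weight $wt(v)\in\mathbb R$ let $v[m]=m!\sum_{i\ge m}c(wt(v),i,m)\,v(i)$ for $m\ge0$, where $\sum_{m=0}^{i}c(w,i,m)x^m=\binom{w-1+x}{i}$, and let $o(v)=v(wt(v)-1)$ if $wt(v)\in\mathbb Z$, and $o(v)=0$ otherwise. For $|\theta|=|\phi|=1$, $\phi=e^{2\pi i\lambda}$ with $0\le\lambda<1$, and $k\ge1$, let $P_k\!\left[{\theta\atop\phi}\right](z,\tau)$ be the analytic continuation to $z\in\mathbb C\setminus2\pi i(\mathbb Z\tau+\mathbb Z)$ of $$\frac{(-1)^k}{(k-1)!}\sum_{n\in\mathbb Z+\lambda}{}^{\!\!\prime}\ \frac{n^{k-1}e^{nz}}{1-\theta^{-1}q^n}\qquad(|q|<|e^z|<1),$$ where the prime means that $n=0$ is omitted if $(\theta,\phi)=(1,1)$. Let $v$ be homogeneous of weight $wt(v)\in\mathbb R$ and parity $p(v)$ with $gv=\theta^{-1}v$, $|\theta|=1$, let $\phi=e^{2\pi i\,wt(v)}$, and let $v_1,\dots,v_n\in V$ have parities $p(v_1),\dots,p(v_n)$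 (their weights are arbitrary). Then, with $v$ inserted at $z$, $q_z=e^z$, and $v_r$ at $z_r$, $$\begin{aligned}F_M(g;v,v_1,\dots,v_n;\tau)={}&\delta_{\theta,1}\delta_{\phi,1}\,\mathrm{STr}_M\bigl(g\,o(v)Y_M(q_1^{L(0)}v_1,q_1)\cdots Y_M(q_n^{L(0)}v_n,q_n)q^{L(0)-c/24}\bigr)\\&+\sum_{r=1}^n\sum_{m\ge0}(-1)^{p(v)(p(v_1)+\dots+p(v_{r-1}))}P_{m+1}\!\left[{\theta\atop\phi}\right](z-z_r,\tau)\,F_M(g;v_1,\dots,v[m]v_r,\dots,v_n;\tau)\end{aligned}\tag{$*$}$$ in the following two senses. (1) *As functions.* At every point with $|q|<|q_r/q_z|<1$ for all $r$ at which the series for all the $F_M(g;v_1,\dots,v[m]v_r,\dots,v_n;\tau)$ and, if $\theta=\phi=1$, the series for the $o(v)$-supertrace converge absolutely, the series for $F_M(g;v,v_1,\dots,v_n;\tau)$ converges absolutely too, and $(*)$ holds. (2) *As formal series.* Without any convergence assumption, $(*)$ holds coefficient by coefficient as an identity of formal series in real powers of $q_z,q_1,\dots,q_n$ and complex powers of $q$,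 when $P_{m+1}\!\left[{\theta\atop\phi}\right](z-z_r,\tau)$ is replaced by its expansion in powers of $q_z/q_r$ and $q$ in the region $1<|q_z/q_r|<|q|^{-1}$. That expansion (for $x=z-z_r$ in the region $1<|e^x|<|q|^{-1}$, where it converges absolutely to $P_k\!\left[{\theta\atop\phi}\right](x,\tau)$) is $$\frac{(-1)^{k}}{(k-1)!}\Bigl(-\sum_{n<0}\sum_{j\ge0}n^{k-1}\theta^{j}e^{nx}q^{-nj}+\sum_{n>0}\sum_{j\ge1}n^{k-1}\theta^{-j}e^{nx}q^{nj}-\delta_{\phi,1}\delta_{k,1}\,\epsilon\Bigr),\qquad n\in\mathbb Z+\lambda,$$ with $\epsilon=1$ if $\theta=1$ and $\epsilon=(1-\theta)^{-1}$ otherwise. -/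

import Mathlib

noncomputable section

/-! ### Twisted Weierstrass functions -/

/-- `q = exp (2πiτ)`. -/
def nome (τ : ℂ) : ℂ := Complex.exp (2 * Real.pi * Complex.I * τ)

/-- The unique `λ ∈ [0, 1)` with `φ = exp (2πiλ)`, for `φ` of modulus one. -/
def twistExponent (φ : ℂ) : ℝ := Int.fract (Complex.arg φ / (2 * Real.pi))

/-- The lattice `2πi (ℤτ + ℤ)`. -/
def periodLattice (τ : ℂ) : Set ℂ :=
  {z | ∃ m n : ℤ, z = 2 * Real.pi * Complex.I * (m * τ + n)}

/-- The series `(-1)^k/(k-1)! ∑'_{n ∈ ℤ + λ} n^(k-1) q_z^n / (1 - θ⁻¹ q^n)`, where `q_z = exp z` and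
the term `n = 0` is left out when `(θ, φ) = (1, 1)`. It converges for `|q| < |q_z| < 1`. -/
def twistedSeries (k : ℕ) (θ φ z τ : ℂ) : ℂ :=
  (-1) ^ k / ((k - 1).factorial : ℂ) * ∑' j : ℤ,
    (let n : ℝ := j + twistExponent φ
     if n = 0 ∧ θ = 1 then 0
     else (n : ℂ) ^ (k - 1) * Complex.exp (n * z) /
        (1 - θ⁻¹ * Complex.exp (2 * Real.pi * Complex.I * τ * n)))

/-- `P` is the continuation of the series to a function holomorphic off the period lattice. -/
def IsTwistedWeierstrass (k : ℕ) (θ φ τ : ℂ) (P : ℂ → ℂ) : Prop :=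
  DifferentiableOn ℂ P (periodLattice τ)ᶜ ∧
    ∀ z : ℂ, ‖nome τ‖ < ‖Complex.exp z‖ → ‖Complex.exp z‖ < 1 → P z = twistedSeries k θ φ z τ

/-- The twisted Weierstrass function `P_k[θ; φ](z, τ)`: the analytic continuation in `z` of the
series from the annulus `|q| < |q_z| < 1` to the complement of the period lattice. (The complement
is connected, so the continuation is unique there.) -/
def twistedP (k : ℕ) (θ φ z τ : ℂ) : ℂ :=
  Classical.epsilon (IsTwistedWeierstrass k θ φ τ) z

/-- The coefficient of `q_z^n q^(|n| j)` in the expansion of `P_k[θ; φ](z, τ)` in the annulus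
`1 < |q_z| < |q|⁻¹`. -/
def twistedPCoeff (k : ℕ) (θ φ : ℂ) (n : ℝ) (j : ℕ) : ℂ :=
  if Complex.exp (2 * Real.pi * Complex.I * n) = φ then
    (-1) ^ k / ((k - 1).factorial : ℂ) * (n : ℂ) ^ (k - 1) *
      (if n < 0 then -θ ^ j
       else if 0 < n then (if j = 0 then 0 else (θ⁻¹) ^ j)
       else if j = 0 then (if θ = 1 then -1 else -(1 - θ)⁻¹) else 0)
  else 0

/-! ### Vertex operator superalgebras -/

/-- `(-1)^α` for a parity `α`. -/
def paritySign (α : ZMod 2) : ℂ := if α = 0 then 1 else -1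

/-- The projection to the `i`-th summand of an internal direct sum. -/
def gradeProj {E ι : Type*} [AddCommGroup E] [Module ℂ E] [DecidableEq ι] {A : ι → Submodule ℂ E}
    (h : DirectSum.IsInternal A) (i : ι) : E →ₗ[ℂ] A i :=
  DirectSum.component ℂ ι (fun i => A i) i ∘ₗ
    (LinearEquiv.ofBijective (DirectSum.coeLinearMap A) h).symm.toLinearMap

/-- An `ℝ`-graded vertex operator superalgebra. The superspace structure is given by its parity
involution `σ`, with `V_α = {a | σ a = (-1)^α a}`; `Y a n` is the mode `a(n)` in
`Y(a, z) = ∑ a(n) z^(-n-1)`, and `L(n) = ω(n+1)`. -/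
structure VOSA (V : Type*) [AddCommGroup V] [Module ℂ V] where
  σ : V →ₗ[ℂ] V
  σ_σ : ∀ a, σ (σ a) = a
  Y : V →ₗ[ℂ] (ℤ → Module.End ℂ V)
  vac : V
  ω : V
  c : ℂ
  /-- `a(n) V_β ⊆ V_{β + p(a)}` -/
  parity : ∀ (α β : ZMod 2) (a b : V) (n : ℤ), σ a = paritySign α • a → σ b = paritySign β • b →
    σ (Y a n b) = paritySign (α + β) • Y a n b
  truncation : ∀ a b, ∃ N : ℤ, ∀ n, N ≤ n → Y a n b = 0
  vacuum : ∀ n, Y vac n = if n = -1 then 1 else 0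
  creation : ∀ (a : V) (n : ℤ), -1 ≤ n → Y a n vac = if n = -1 then a else 0
  /-- `(x - y)^N [Y(a, x), Y(b, y)] = 0`, coefficient by coefficient -/
  locality : ∀ (α β : ZMod 2) (a b : V), σ a = paritySign α • a → σ b = paritySign β • b →
    ∃ N : ℕ, ∀ m n : ℤ, ∑ j ∈ Finset.range (N + 1), ((-1 : ℂ) ^ j * (N.choose j : ℂ)) •
      (Y a (m + N - j) * Y b (n + j) - paritySign (α * β) • (Y b (n + j) * Y a (m + N - j))) = 0
  virasoro : ∀ m n : ℤ, Y ω (m + 1) * Y ω (n + 1) - Y ω (n + 1) * Y ω (m + 1) =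
    ((m : ℂ) - n) • Y ω (m + n + 1) +
      (if m = -n then c / 12 * ((m : ℂ) ^ 3 - m) else 0) • (1 : Module.End ℂ V)
  /-- `Y(L(-1)a, z) = d/dz Y(a, z)` -/
  translation : ∀ (a : V) (n : ℤ), Y (Y ω 0 a) n = (-(n : ℂ)) • Y a (n - 1)
  σ_vac : σ vac = vac
  σ_ω : σ ω = ω
  /-- `V = ⨁ V_r`, with `V_r` the eigenspace of `L(0)` -/
  internal : DirectSum.IsInternal (fun r : ℝ => (Y ω 1).eigenspace (r : ℂ))
  bounded_below : ∃ r₀ : ℝ, ∀ r < r₀, (Y ω 1).eigenspace (r : ℂ) = ⊥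
  countable : {r : ℝ | (Y ω 1).eigenspace (r : ℂ) ≠ ⊥}.Countable
  vac_weight : vac ∈ (Y ω 1).eigenspace 0
  ω_weight : ω ∈ (Y ω 1).eigenspace 2

namespace VOSA

variable {V : Type*} [AddCommGroup V] [Module ℂ V] (𝒱 : VOSA V)

/-- `a` has parity `α`. -/
def HasParity (α : ZMod 2) (a : V) : Prop := 𝒱.σ a = paritySign α • a

/-- `V_r`, the vectors of weight `r`. -/
def weightSpace (r : ℝ) : Submodule ℂ V := (𝒱.Y 𝒱.ω 1).eigenspace (r : ℂ)

/-- The component of weight `r` of a vector. -/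
def weightProj (r : ℝ) (a : V) : V := (gradeProj 𝒱.internal r a : V)

/-- The coefficient `c(w, i, m)` of `x^m` in `binom(w - 1 + x, i)`. -/
def sqCoeff (w : ℝ) (i m : ℕ) : ℂ :=
  (((i.factorial : ℂ)⁻¹) • (descPochhammer ℂ i).comp
    (Polynomial.X + Polynomial.C ((w : ℂ) - 1))).coeff m

/-- The square bracket mode `v[m] u = m! ∑_{i ≥ m} c(w, i, m) v(i) u`, for `v` of weight `w`
and `m ≥ 0`. -/
def sqMode (w : ℝ) (v : V) (m : ℕ) (u : V) : V :=
  ∑ᶠ i : ℕ, ((m.factorial : ℂ) * sqCoeff w i m) • 𝒱.Y v (i : ℤ) u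

/-- Automorphisms of a VOSA that commute with the parity automorphism. -/
structure Automorphism where
  toEquiv : V ≃ₗ[ℂ] V
  map_mode : ∀ (a b : V) (n : ℤ), toEquiv (𝒱.Y a n b) = 𝒱.Y (toEquiv a) n (toEquiv b)
  map_vac : toEquiv 𝒱.vac = 𝒱.vac
  map_ω : toEquiv 𝒱.ω = 𝒱.ω
  map_σ : ∀ a, toEquiv (𝒱.σ a) = 𝒱.σ (toEquiv a)

end VOSA

/-- A module for a VOSA: a superspace on which `L(0)` is diagonalizable with finite dimensional
eigenspaces and with eigenvalues bounded below along each real line, with vertex operators that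
satisfy the Jacobi identity (written out in modes). -/
structure VOSAModule {V : Type*} [AddCommGroup V] [Module ℂ V] (𝒱 : VOSA V)
    (M : Type*) [AddCommGroup M] [Module ℂ M] where
  σ : M →ₗ[ℂ] M
  σ_σ : ∀ w, σ (σ w) = w
  Y : V →ₗ[ℂ] (ℤ → Module.End ℂ M)
  parity : ∀ (α β : ZMod 2) (a : V) (w : M) (n : ℤ), 𝒱.HasParity α a → σ w = paritySign β • w →
    σ (Y a n w) = paritySign (α + β) • Y a n w
  truncation : ∀ (a : V) (w : M), ∃ N : ℤ, ∀ n, N ≤ n → Y a n w = 0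
  vacuum : ∀ n, Y 𝒱.vac n = if n = -1 then 1 else 0
  jacobi : ∀ (α β : ZMod 2) (a b : V) (w : M) (m n k : ℤ), 𝒱.HasParity α a → 𝒱.HasParity β b →
    ∑ᶠ i : ℕ, (Ring.choose m i : ℂ) • Y (𝒱.Y a (n + i) b) (m + k - i) w =
      ∑ᶠ i : ℕ, ((-1) ^ i * (Ring.choose n i : ℂ)) •
        (Y a (m + n - i) (Y b (k + i) w) -
          ((-1 : ℂ) ^ n * paritySign (α * β)) • Y b (n + k - i) (Y a (m + i) w))
  internal : DirectSum.IsInternal (fun h : ℂ => (Y 𝒱.ω 1).eigenspace h)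
  finite : ∀ h : ℂ, FiniteDimensional ℂ ((Y 𝒱.ω 1).eigenspace h)
  bounded_below : ∀ h : ℂ, ∃ x₀ : ℝ, ∀ x : ℝ, x < x₀ → (Y 𝒱.ω 1).eigenspace (h + x) = ⊥

namespace VOSAModule

variable {V : Type*} [AddCommGroup V] [Module ℂ V] {𝒱 : VOSA V}
  {M : Type*} [AddCommGroup M] [Module ℂ M] (ℳ : VOSAModule 𝒱 M)

/-- An action on `M` of an automorphism `g` of `V`, commuting with the parity involution. -/
structure Lift (g : 𝒱.Automorphism) where
  toEquiv : M ≃ₗ[ℂ] M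
  map_mode : ∀ (a : V) (w : M) (n : ℤ), toEquiv (ℳ.Y a n w) = ℳ.Y (g.toEquiv a) n (toEquiv w)
  map_σ : ∀ w, toEquiv (ℳ.σ w) = ℳ.σ (toEquiv w)

/-- The component of degree `d` of the vertex operator of `a`: it is `a(wt(a) - d - 1)` for
homogeneous `a` (and zero unless `wt(a) - d ∈ ℤ`), extended linearly, so that
`Y_M(x^{L(0)} a, x) = ∑_d degMode a d x^d`. -/
def degMode (a : V) (d : ℝ) : Module.End ℂ M :=
  ∑ᶠ k : ℤ, ℳ.Y (𝒱.weightProj (d + k + 1) a) k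

/-- The zero mode `o(a)`. -/
def zeroMode (a : V) : Module.End ℂ M := ℳ.degMode a 0

/-- The supertrace of `X` on the eigenspace `M_h` of `L(0)`, that is the trace of `σ X`
(compressed to `M_h`). -/
def strAt (X : Module.End ℂ M) (h : ℂ) : ℂ :=
  LinearMap.trace ℂ ((ℳ.Y 𝒱.ω 1).eigenspace h)
    (gradeProj ℳ.internal h ∘ₗ ℳ.σ ∘ₗ X ∘ₗ ((ℳ.Y 𝒱.ω 1).eigenspace h).subtype)

variable {ℳ} {g : 𝒱.Automorphism} (gM : ℳ.Lift g)

/-- The coefficient of `q_1^{d_1} ⋯ q_n^{d_n} q^{h - c/24}` in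
`STr_M (g A Y_M(q_1^{L(0)} u_1, q_1) ⋯ Y_M(q_n^{L(0)} u_n, q_n) q^{L(0) - c/24})`. -/
def Lift.coeff (A : Module.End ℂ M) {n : ℕ} (u : Fin n → V) (d : Fin n → ℝ) (h : ℂ) : ℂ :=
  ℳ.strAt (gM.toEquiv.toLinearMap * A * (List.ofFn fun i => ℳ.degMode (u i) (d i)).prod) h

/-- The terms of that series at `q_i = exp z_i`, `q = exp (2πiτ)`. -/
def Lift.term (A : Module.End ℂ M) {n : ℕ} (u : Fin n → V) (z : Fin n → ℂ) (τ : ℂ)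
    (p : (Fin n → ℝ) × ℂ) : ℂ :=
  gM.coeff A u p.1 p.2 * Complex.exp (∑ i, (p.1 i : ℂ) * z i) *
    Complex.exp (2 * Real.pi * Complex.I * τ * (p.2 - 𝒱.c / 24))

/-- `STr_M (g A Y_M(q_1^{L(0)} u_1, q_1) ⋯ Y_M(q_n^{L(0)} u_n, q_n) q^{L(0) - c/24})`. -/
def Lift.str (A : Module.End ℂ M) {n : ℕ} (u : Fin n → V) (z : Fin n → ℂ) (τ : ℂ) : ℂ :=
  ∑' p, gM.term A u z τ p

/-- The `n`-point function `F_M(g; (u_1, z_1), …, (u_n, z_n); τ)`. -/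
def Lift.nPoint {n : ℕ} (u : Fin n → V) (z : Fin n → ℂ) (τ : ℂ) : ℂ := gM.str 1 u z τ

end VOSAModule

end

noncomputable section

/-! Fix exponents and let `T h` be the coefficient in which `v` has degree `d₀`, so that `v` acts by
the single mode `v(k)` with `k = wt - 1 - d₀`. Move `v(k)` to the right through the product. This
leaves one commutator for each factor, plus a term with `v(k)` at the far right. Cyclicity of the
trace brings that term back to the front: it passes `g` with a factor `θ`, and the trace over `M_h`
becomes one over `M_{h+d₀}`. The signs cancel unless the total parity is odd, and then the
supertrace is zero. Hence `T h = R h + θ * T (h + d₀)` with `R` the sum of commutators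
(`strAt_recursion`). Since the weights of `M` are bounded below along real lines, the recursion can
be iterated towards lower weights until it stops. This determines `T`, except when `θ = 1` and `d₀ =
0`, where `T` is the zero-mode term itself (`solve_recursion`). In `R`, the expansion of `binom(wt -
1 - d₀, i)` in powers of `-d₀` turns the modes `v(i)` into the square bracket modes `v[m]` with
coefficient `(-d₀)^m / m!` (`degMode_commutator_sqMode`). The resulting coefficients are exactly
those of the twisted Weierstrass functions in the outer annulus, which gives the formal identity
`coeff_formal_recursion`. For functions, the absolutely convergent expansion of each Weierstrass
function is multiplied by an absolutely convergent n-point series and regrouped. Each group is a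
finite sum occurring in the formal identity, so convergence of the left side follows as well
(`hasSum_recursion_term`). Two ingredients need separate proofs. One is that the continuation from
the inner annulus has the stated outer expansion: both halves of the series are sums of geometric
series, and only one rational function of `e^z` changes its expansion across `Re z = 0`
(`hasSum_twistedBase_outer`). The other is that modes of homogeneous vectors shift weights in `V`.
It is deduced from locality and creation by Dong's lemma and a Goddard-type uniqueness argument
(`mode_mem_weightSpace`). -/

lemma HasSum.congr_terms {ι : Type*} {f g : ι → ℂ} {a : ℂ} (h : HasSum f a)
    (e : ∀ i, g i = f i) : HasSum g a := by
  rwa [funext e]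

/-! ### Termwise differentiation of exponential series -/

open Complex in
-- On a narrower strip `x₁ < Re w < x₂` every term is dominated by the sum of its absolute values at
-- the real points `x₁` and `x₂`, because `exp (c x)` is monotone in `x` whatever the sign of `c`.
-- Weierstrass' theorem then allows termwise differentiation.
lemma hasSum_deriv_exp {ι : Type*} {a : ι → ℂ} {c : ι → ℝ} {α β : ℝ} {G : ℂ → ℂ}
    (h : ∀ z : ℂ, α < z.re → z.re < β → HasSum (fun i => a i * exp (c i * z)) (G z))
    {z : ℂ} (hz : α < z.re) (hz' : z.re < β) :
    HasSum (fun i => a i * c i * exp (c i * z)) (deriv G z) := by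
  obtain ⟨x₁, h1, h1'⟩ := exists_between hz
  obtain ⟨x₂, h2, h2'⟩ := exists_between hz'
  have hs1 := (h (x₁ : ℂ) (by simpa using h1) (by simp; linarith)).summable.norm
  have hs2 := (h (x₂ : ℂ) (by simp; linarith) (by simpa using h2')).summable.norm
  have hU : IsOpen {w : ℂ | x₁ < w.re ∧ w.re < x₂} :=
    (isOpen_lt continuous_const continuous_re).inter (isOpen_lt continuous_re continuous_const)
  have key := Complex.hasSum_deriv_of_summable_norm (z := z) (F := fun i w => a i * exp (c i * w))
    (hs1.add hs2) (fun i => by fun_prop) hU ?_ ⟨h1', h2⟩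
  · have e1 : deriv (fun w => ∑' i, a i * exp (c i * w)) z = deriv G z := by
      apply Filter.EventuallyEq.deriv_eq
      filter_upwards [hU.mem_nhds ⟨h1', h2⟩] with w hw
      exact (h w (h1.trans hw.1) (hw.2.trans h2')).tsum_eq
    rw [e1] at key
    refine key.congr_terms fun i => ?_
    have : HasDerivAt (fun w => a i * exp (c i * w)) (a i * (exp (c i * z) * (c i * 1))) z :=
      (((hasDerivAt_id z).const_mul (c i : ℂ)).cexp).const_mul (a i)
    rw [this.deriv]; ring
  · rintro i w ⟨hw1, hw2⟩
    simp only [norm_mul, norm_exp, mul_re, ofReal_re, ofReal_im, zero_mul, sub_zero]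
    rw [← mul_add]
    gcongr
    rcases le_total 0 (c i) with hc | hc
    · have : Real.exp (c i * w.re) ≤ Real.exp (c i * x₂) := by gcongr
      linarith [Real.exp_pos (c i * x₁)]
    · have : Real.exp (c i * w.re) ≤ Real.exp (c i * x₁) :=
        Real.exp_le_exp.mpr (mul_le_mul_of_nonpos_left hw1.le hc)
      linarith [Real.exp_pos (c i * x₂)]

open Complex in
lemma hasSum_iteratedDeriv_exp {ι : Type*} {a : ι → ℂ} {c : ι → ℝ} {α β : ℝ} {G : ℂ → ℂ}
    (h : ∀ z : ℂ, α < z.re → z.re < β → HasSum (fun i => a i * exp (c i * z)) (G z)) (k : ℕ) :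
    ∀ z : ℂ, α < z.re → z.re < β →
      HasSum (fun i => a i * (c i : ℂ) ^ k * exp (c i * z)) (iteratedDeriv k G z) := by
  induction k with
  | zero => simpa using h
  | succ k ih =>
    intro z hz hz'
    rw [iteratedDeriv_succ]
    simpa only [pow_succ, mul_assoc] using
      hasSum_deriv_exp (a := fun i => a i * (c i : ℂ) ^ k) ih hz hz'

lemma DifferentiableOn.iteratedDeriv_of_isOpen {U : Set ℂ} {f : ℂ → ℂ} (hf : DifferentiableOn ℂ f U)
    (hU : IsOpen U) (k : ℕ) : DifferentiableOn ℂ (iteratedDeriv k f) U := by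
  induction k with
  | zero => simpa using hf
  | succ k ih => rw [iteratedDeriv_succ]; exact ih.deriv hU

/-! ### Sums of geometric series and their continuation -/

open Complex in
/-- `∑_{n ∈ μ + ℕ} e^{nw}` for `Re w < 0`, continued to the plane. -/
def geomExp (μ : ℝ) (w : ℂ) : ℂ := exp (μ * w) / (1 - exp w)

open Complex in
/-- `∑_{j ≥ 0} θ^j ∑_{n ∈ μ + ℕ} e^{n(z + 2πiτj)}`, continued in `z`. -/
def geomExpSum (μ : ℝ) (θ τ z : ℂ) : ℂ :=
  ∑' j : ℕ, θ ^ j * geomExp μ (z + 2 * Real.pi * I * τ * j)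

open Complex in
lemma shift_re (z τ : ℂ) (x : ℝ) :
    (z + 2 * Real.pi * I * τ * x).re = z.re - 2 * Real.pi * τ.im * x := by
  simp; ring

open Complex in
lemma norm_geomExp_le {μ : ℝ} {w : ℂ} {t : ℝ} (ht : 0 < t) (hw : w.re ≤ -t) :
    ‖geomExp μ w‖ ≤ Real.exp (μ * w.re) / (1 - Real.exp (-t)) := by
  have h1 : Real.exp (-t) < 1 := by simpa using ht
  have h2 : ‖exp w‖ ≤ Real.exp (-t) := by rw [norm_exp]; gcongr
  have h3 : 1 - Real.exp (-t) ≤ ‖1 - exp w‖ := by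
    have := norm_sub_norm_le (1 : ℂ) (exp w)
    rw [norm_one] at this; linarith
  unfold geomExp
  rw [norm_div, norm_exp]
  simp only [mul_re, ofReal_re, ofReal_im, zero_mul, sub_zero]
  gcongr

open Complex in
-- On the half plane `Re z < 2π Im τ · J`, the terms with index beyond `J` are evaluated at distance
-- at least `2π Im τ` to the left of the poles of `geomExp`. The tail is therefore dominated
-- geometrically and uniformly there, and only finitely many terms can have poles.
lemma norm_geomExpSum_term_le {μ : ℝ} (hμ : 0 < μ) {θ τ : ℂ} (hθ : ‖θ‖ = 1) (hτ : 0 < τ.im) (J : ℕ)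
    {z : ℂ} (hz : z.re < 2 * Real.pi * τ.im * J) (j : ℕ) :
    ‖θ ^ (j + (J + 1)) * geomExp μ (z + 2 * Real.pi * I * τ * ((j + (J + 1) : ℕ) : ℂ))‖ ≤
      Real.exp (-(μ * (2 * Real.pi * τ.im))) ^ j * (1 / (1 - Real.exp (-(2 * Real.pi * τ.im)))) := by
  have ht : 0 < 2 * Real.pi * τ.im := by positivity
  set t := 2 * Real.pi * τ.im with htd
  have hre : (z + 2 * Real.pi * I * τ * ((j + (J + 1) : ℕ) : ℂ)).re = z.re - t * (j + (J + 1)) := by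
    have := shift_re z τ ((j + (J + 1) : ℕ) : ℝ)
    push_cast at this ⊢
    rw [this]
  have hle : z.re - t * (j + (J + 1)) ≤ -t * (j + 1) := by nlinarith
  rw [norm_mul, norm_pow, hθ, one_pow, one_mul]
  refine (norm_geomExp_le ht ?_).trans ?_
  · rw [hre]; nlinarith [mul_nonneg ht.le (Nat.cast_nonneg (α := ℝ) j)]
  · rw [hre, mul_one_div, ← Real.exp_nat_mul]
    have : Real.exp (-t) < 1 := by simpa using ht
    have h0 : 0 < 1 - Real.exp (-t) := by linarith
    refine div_le_div_of_nonneg_right (Real.exp_le_exp.mpr ?_) h0.le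
    have := mul_le_mul_of_nonneg_left hle hμ.le
    nlinarith [mul_pos hμ ht]

lemma summable_geomExpSum_bound {μ t : ℝ} (h : 0 < μ * t) (C : ℝ) :
    Summable fun j : ℕ => Real.exp (-(μ * t)) ^ j * C :=
  (summable_geometric_of_lt_one (Real.exp_pos _).le (by simpa using h)).mul_right _

open Complex in
lemma summable_geomExpSum {μ : ℝ} (hμ : 0 < μ) {θ τ : ℂ} (hθ : ‖θ‖ = 1) (hτ : 0 < τ.im) (z : ℂ) :
    Summable fun j : ℕ => θ ^ j * geomExp μ (z + 2 * Real.pi * I * τ * j) := by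
  have ht : 0 < 2 * Real.pi * τ.im := by positivity
  obtain ⟨J, hJ⟩ := exists_nat_gt (z.re / (2 * Real.pi * τ.im))
  rw [div_lt_iff₀ ht, mul_comm] at hJ
  rw [← summable_nat_add_iff (J + 1)]
  exact Summable.of_norm_bounded (summable_geomExpSum_bound (mul_pos hμ ht) _)
    (norm_geomExpSum_term_le hμ hθ hτ J hJ)

open Complex in
lemma differentiableAt_geomExpSum {μ : ℝ} (hμ : 0 < μ) {θ τ : ℂ} (hθ : ‖θ‖ = 1) (hτ : 0 < τ.im)
    {z : ℂ} (hz : ∀ j : ℕ, exp (z + 2 * Real.pi * I * τ * j) ≠ 1) :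
    DifferentiableAt ℂ (geomExpSum μ θ τ) z := by
  have ht : 0 < 2 * Real.pi * τ.im := by positivity
  obtain ⟨J, hJ⟩ := exists_nat_gt (z.re / (2 * Real.pi * τ.im))
  rw [div_lt_iff₀ ht, mul_comm] at hJ
  have hU : IsOpen {w : ℂ | w.re < 2 * Real.pi * τ.im * J} :=
    isOpen_lt continuous_re continuous_const
  have heq : geomExpSum μ θ τ = fun z =>
      ∑ j ∈ Finset.range (J + 1), θ ^ j * geomExp μ (z + 2 * Real.pi * I * τ * j) +
      ∑' j : ℕ, θ ^ (j + (J + 1)) *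
        geomExp μ (z + 2 * Real.pi * I * τ * ((j + (J + 1) : ℕ) : ℂ)) := by
    funext w
    exact ((summable_geomExpSum hμ hθ hτ w).sum_add_tsum_nat_add (J + 1)).symm
  rw [heq]
  refine DifferentiableAt.add ?_ ?_
  · refine DifferentiableAt.fun_sum fun j _ => ?_
    unfold geomExp
    have := sub_ne_zero.mpr (hz j).symm
    fun_prop (disch := assumption)
  · refine (differentiableOn_tsum_of_summable_norm (summable_geomExpSum_bound (mul_pos hμ ht) _)
      (fun j => ?_) hU (fun j w hw => norm_geomExpSum_term_le hμ hθ hτ J hw j)).differentiableAt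
      (hU.mem_nhds hJ)
    intro w hw
    apply DifferentiableAt.differentiableWithinAt
    have : 1 - exp (w + 2 * Real.pi * I * τ * ((j + (J + 1) : ℕ) : ℂ)) ≠ 0 := by
      rw [sub_ne_zero]
      intro h
      have h2 := congrArg norm h.symm
      have h3 := shift_re w τ ((j + (J + 1) : ℕ) : ℝ)
      simp only [ofReal_natCast] at h3
      rw [norm_exp, norm_one, Real.exp_eq_one_iff, h3] at h2
      have hw' : w.re < 2 * Real.pi * τ.im * J := hw
      push_cast at h2
      nlinarith [mul_nonneg ht.le (Nat.cast_nonneg (α := ℝ) j)]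
    unfold geomExp
    fun_prop (disch := assumption)

open Complex in
lemma hasSum_geomExp (μ : ℝ) {w : ℂ} (hw : w.re < 0) :
    HasSum (fun l : ℕ => exp ((μ + l : ℝ) * w)) (geomExp μ w) := by
  have : ‖exp w‖ < 1 := by rw [norm_exp]; simpa using hw
  have h := (hasSum_geometric_of_norm_lt_one this).mul_left (exp (μ * w))
  rw [← div_eq_mul_inv] at h
  refine h.congr_terms fun l => ?_
  rw [← exp_nat_mul, ← exp_add]; congr 1; push_cast; ring

open Complex in
-- Dropping the cross term `l · 2π Im τ · j` from the exponent bounds the double series by a product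
-- of two geometric series. Summed over `l` first it is the definition; summed over `j` first it
-- gives the denominators `1 - θ qⁿ`.
lemma hasSum_geomExpSum {μ : ℝ} (hμ : 0 < μ) {θ τ : ℂ} (hθ : ‖θ‖ = 1) (hτ : 0 < τ.im)
    {z : ℂ} (hz : z.re < 0) :
    HasSum (fun s : ℕ × ℕ => θ ^ s.2 * exp ((μ + s.1 : ℝ) * (z + 2 * Real.pi * I * τ * s.2)))
      (geomExpSum μ θ τ z) := by
  have ht : 0 < 2 * Real.pi * τ.im := by positivity
  have hre : ∀ j : ℕ, (z + 2 * Real.pi * I * τ * j).re = z.re - 2 * Real.pi * τ.im * j :=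
    fun j => by simpa using shift_re z τ j
  have hsum : Summable (fun s : ℕ × ℕ =>
      θ ^ s.2 * exp ((μ + s.1 : ℝ) * (z + 2 * Real.pi * I * τ * s.2))) := by
    have h1 : Summable fun l : ℕ => Real.exp (μ * z.re) * Real.exp z.re ^ l :=
      (summable_geometric_of_lt_one (Real.exp_pos _).le (by simpa using hz)).mul_left _
    have h2 := summable_geomExpSum_bound (mul_pos hμ ht) 1
    refine Summable.of_norm_bounded (h1.mul_of_nonneg h2 (fun _ => by positivity)
      (fun _ => by positivity)) ?_
    rintro ⟨l, j⟩
    simp only [norm_mul, norm_pow, hθ, one_pow, one_mul, norm_exp, mul_one]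
    rw [re_ofReal_mul, hre, ← Real.exp_nat_mul, ← Real.exp_nat_mul, ← Real.exp_add, ← Real.exp_add]
    gcongr
    have : 0 ≤ (l : ℝ) * (2 * Real.pi * τ.im * j) := by positivity
    nlinarith
  have h1 := hsum.hasSum
  have h3 : ∀ j : ℕ, HasSum
      (fun l : ℕ => θ ^ j * exp ((μ + l : ℝ) * (z + 2 * Real.pi * I * τ * j)))
      (θ ^ j * geomExp μ (z + 2 * Real.pi * I * τ * j)) := fun j => by
    refine (hasSum_geomExp μ ?_).mul_left _
    rw [hre]
    have : 0 ≤ 2 * Real.pi * τ.im * j := by positivity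
    linarith
  have h2 := ((Equiv.prodComm ℕ ℕ).hasSum_iff.mpr h1).prod_fiberwise h3
  rw [show geomExpSum μ θ τ z = _ from h2.tsum_eq]
  exact h1

open Complex in
lemma geomExpSum_eq_add {μ : ℝ} (hμ : 0 < μ) {θ τ : ℂ} (hθ : ‖θ‖ = 1) (hτ : 0 < τ.im) (z : ℂ) :
    geomExpSum μ θ τ z = geomExp μ z + θ * geomExpSum μ θ τ (z + 2 * Real.pi * I * τ) := by
  unfold geomExpSum
  rw [(summable_geomExpSum hμ hθ hτ z).tsum_eq_zero_add, ← tsum_mul_left]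
  congr 1
  · simp
  · congr 1; funext j; rw [pow_succ']; push_cast; rw [mul_assoc]; congr 3; ring

/-! ### The period lattice and uniqueness of the continuation -/

open Complex in
lemma mem_periodLattice_of_exp_eq_one {z τ : ℂ} {x : ℤ}
    (h : exp (z + 2 * Real.pi * I * τ * x) = 1) : z ∈ periodLattice τ := by
  obtain ⟨n, hn⟩ := exp_eq_one_iff.mp h
  refine ⟨-x, n, ?_⟩
  push_cast
  linear_combination hn

/-- The real coordinates of `z / 2πi` in the basis `τ, 1` are continuous, and the lattice is where
both are integers. -/
lemma isClosed_periodLattice {τ : ℂ} (hτ : 0 < τ.im) : IsClosed (periodLattice τ) := by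
  have h0 : (2 * Real.pi * Complex.I : ℂ) ≠ 0 := Complex.two_pi_I_ne_zero
  have : periodLattice τ =
      (fun z : ℂ => (z / (2 * Real.pi * Complex.I)).im / τ.im) ⁻¹' Set.range (Int.cast : ℤ → ℝ) ∩
      (fun z : ℂ => (z / (2 * Real.pi * Complex.I)).re -
        (z / (2 * Real.pi * Complex.I)).im / τ.im * τ.re) ⁻¹' Set.range (Int.cast : ℤ → ℝ) := by
    ext z
    constructor
    · rintro ⟨m, n, rfl⟩
      refine ⟨⟨m, ?_⟩, ⟨n, ?_⟩⟩ <;> beta_reduce <;> rw [mul_div_cancel_left₀ _ h0] <;> simp <;>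
        field_simp
      ring
    · rintro ⟨⟨m, hm⟩, ⟨n, hn⟩⟩
      refine ⟨m, n, ?_⟩
      rw [mul_comm, ← div_eq_iff h0]
      apply Complex.ext
      · simp only [← hm] at hn; simp; linarith
      · rw [eq_div_iff hτ.ne'] at hm; simp; linarith
  rw [this]
  have hc := Int.isClosedEmbedding_coe_real.isClosed_range
  exact (hc.preimage (by fun_prop (disch := exact hτ.ne'))).inter (hc.preimage (by fun_prop (disch := exact hτ.ne')))

lemma countable_periodLattice (τ : ℂ) : (periodLattice τ).Countable := by
  have : periodLattice τ = Set.range fun p : ℤ × ℤ =>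
      2 * Real.pi * Complex.I * ((p.1 : ℂ) * τ + p.2) := by
    ext z; simp [periodLattice, eq_comm]
  rw [this]; exact Set.countable_range _

lemma norm_nome (τ : ℂ) : ‖nome τ‖ = Real.exp (-(2 * Real.pi * τ.im)) := by
  rw [nome, Complex.norm_exp]; simp

lemma notMem_periodLattice {τ z : ℂ} (hτ : 0 < τ.im) (m : ℤ) (h1 : 2 * Real.pi * τ.im * m < z.re)
    (h2 : z.re < 2 * Real.pi * τ.im * (m + 1)) : z ∉ periodLattice τ := by
  have ht : 0 < 2 * Real.pi * τ.im := by positivity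
  rintro ⟨a, b, rfl⟩
  have : (2 * Real.pi * Complex.I * (a * τ + b)).re = 2 * Real.pi * τ.im * (-a : ℤ) := by
    simp; ring
  rw [this] at h1 h2
  have h1 := lt_of_mul_lt_mul_left h1 ht.le
  have h2 := lt_of_mul_lt_mul_left h2 ht.le
  have h1' : m < -a := by exact_mod_cast h1
  have h2' : -a < m + 1 := by exact_mod_cast h2
  omega

/-- The complement of a countable set in the plane is connected, so the identity theorem applies.
This is what makes the choice in `twistedP` harmless off the lattice. -/
lemma IsTwistedWeierstrass.eqOn {k : ℕ} {θ φ τ : ℂ} (hτ : 0 < τ.im) {P Q : ℂ → ℂ}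
    (hP : IsTwistedWeierstrass k θ φ τ P) (hQ : IsTwistedWeierstrass k θ φ τ Q) :
    Set.EqOn P Q (periodLattice τ)ᶜ := by
  have ht : 0 < 2 * Real.pi * τ.im := by positivity
  have hU := (isClosed_periodLattice hτ).isOpen_compl
  -- A point in the middle of the strip `|q| < |e^z| < 1`.
  have hz : ((-(Real.pi * τ.im) : ℝ) : ℂ) ∈ (periodLattice τ)ᶜ := by
    refine notMem_periodLattice hτ (-1) ?_ ?_ <;> rw [Complex.ofReal_re] <;> push_cast <;> nlinarith
  refine AnalyticOnNhd.eqOn_of_preconnected_of_eventuallyEq (hP.1.analyticOnNhd hU)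
    (hQ.1.analyticOnNhd hU) (((countable_periodLattice τ).isPathConnected_compl_of_one_lt_rank
      (by rw [Complex.rank_real_complex]; norm_num)).isConnected.isPreconnected) hz ?_
  have hS : IsOpen {w : ℂ | -(2 * Real.pi * τ.im) < w.re ∧ w.re < 0} :=
    (isOpen_lt continuous_const Complex.continuous_re).inter
      (isOpen_lt Complex.continuous_re continuous_const)
  filter_upwards [hS.mem_nhds (by
    constructor <;> rw [Complex.ofReal_re] <;> nlinarith)] with w hw
  have h1 : ‖nome τ‖ < ‖Complex.exp w‖ := by
    rw [norm_nome, Complex.norm_exp]; exact Real.exp_lt_exp.mpr hw.1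
  have h2 : ‖Complex.exp w‖ < 1 := by rw [Complex.norm_exp]; simpa using hw.2
  rw [hP.2 w h1 h2, hQ.2 w h1 h2]

/-! ### The two annular expansions of the twisted Weierstrass functions -/

open Complex in
lemma hasSum_geomExpSum_fiber {μ : ℝ} (hμ : 0 < μ) {θ τ : ℂ} (hθ : ‖θ‖ = 1) (hτ : 0 < τ.im)
    {z : ℂ} (hz : z.re < 0) :
    HasSum (fun l : ℕ => exp ((μ + l : ℝ) * z) /
      (1 - θ * exp (2 * Real.pi * I * τ * (μ + l : ℝ)))) (geomExpSum μ θ τ z) := by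
  refine (hasSum_geomExpSum hμ hθ hτ hz).prod_fiberwise fun l => ?_
  have hn : 0 < μ + l := by positivity
  have : ‖θ * exp (2 * Real.pi * I * τ * (μ + l : ℝ))‖ < 1 := by
    rw [norm_mul, hθ, one_mul, norm_exp, Real.exp_lt_one_iff, re_mul_ofReal]
    have : 0 < 2 * Real.pi * τ.im * (μ + l) := by positivity
    simp
    linarith
  have h := (hasSum_geometric_of_norm_lt_one this).mul_left (exp ((μ + l : ℝ) * z))
  rw [← div_eq_mul_inv] at h
  refine h.congr_terms fun j => ?_
  rw [mul_pow, ← exp_nat_mul, mul_left_comm, ← exp_add]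
  congr 2; ring

lemma twistExponent_nonneg (φ : ℂ) : 0 ≤ twistExponent φ := Int.fract_nonneg _

lemma twistExponent_lt_one (φ : ℂ) : twistExponent φ < 1 := Int.fract_lt_one _

lemma exp_twistExponent {φ : ℂ} (hφ : ‖φ‖ = 1) :
    Complex.exp (2 * Real.pi * Complex.I * twistExponent φ) = φ := by
  have h := Complex.norm_mul_exp_arg_mul_I φ
  rw [hφ, Complex.ofReal_one, one_mul] at h
  have hpi : (Real.pi : ℂ) ≠ 0 := by exact_mod_cast Real.pi_ne_zero
  conv_rhs => rw [← h]
  rw [Complex.exp_eq_exp_iff_exists_int]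
  refine ⟨-⌊Complex.arg φ / (2 * Real.pi)⌋, ?_⟩
  rw [twistExponent, Int.fract]
  push_cast
  field_simp
  ring

lemma exp_eq_iff_twistExponent {φ : ℂ} (hφ : ‖φ‖ = 1) (x : ℝ) :
    Complex.exp (2 * Real.pi * Complex.I * x) = φ ↔ ∃ l : ℤ, x = l + twistExponent φ := by
  conv_lhs => rw [← exp_twistExponent hφ]
  rw [Complex.exp_eq_exp_iff_exists_int]
  refine exists_congr fun l => ?_
  have : (2 * Real.pi * Complex.I : ℂ) ≠ 0 := Complex.two_pi_I_ne_zero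
  rw [show (2 * Real.pi * Complex.I : ℂ) * (twistExponent φ : ℝ) + l * (2 * Real.pi * Complex.I) =
    2 * Real.pi * Complex.I * ((l + twistExponent φ : ℝ) : ℂ) by push_cast; ring,
    mul_right_inj' this, Complex.ofReal_inj]

/-- The least positive element of `ℤ + λ`. -/
def leastPos (l : ℝ) : ℝ := if l = 0 then 1 else l

lemma leastPos_pos {l : ℝ} (h : 0 ≤ l) : 0 < leastPos l := by
  unfold leastPos; split_ifs with h0
  · exact one_pos
  · exact lt_of_le_of_ne h (Ne.symm h0)

lemma exists_nat_leastPos {l : ℝ} (h1 : l < 1) (m : ℤ) (hm : 0 < m + l) :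
    ∃ n : ℕ, m + l = leastPos l + n := by
  have h2 : (-1 : ℝ) < m := by linarith
  have h3 : -1 < m := by exact_mod_cast h2
  unfold leastPos; split_ifs with h0
  · subst h0
    have : (0 : ℝ) < m := by simpa using hm
    have : 0 < m := by exact_mod_cast this
    obtain ⟨k, rfl⟩ : ∃ k : ℕ, m = k + 1 := ⟨(m - 1).toNat, by omega⟩
    exact ⟨k, by push_cast; ring⟩
  · obtain ⟨k, rfl⟩ := Int.eq_ofNat_of_zero_le (show 0 ≤ m by omega)
    exact ⟨k, by push_cast; ring⟩

lemma exists_nat_neg {l : ℝ} (h0 : 0 ≤ l) (m : ℤ) (hm : m + l < 0) :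
    ∃ n : ℕ, m + l = -((1 - l) + n) := by
  have h2 : (m : ℝ) < 0 := by linarith
  have h3 : m < 0 := by exact_mod_cast h2
  obtain ⟨k, rfl⟩ : ∃ k : ℕ, m = -(k + 1) := ⟨(-m - 1).toNat, by omega⟩
  exact ⟨k, by push_cast; ring⟩

lemma leastPos_add_nat (l : ℝ) (n : ℕ) : ∃ m : ℤ, leastPos l + n = m + l := by
  unfold leastPos; split_ifs with h0
  · exact ⟨n + 1, by subst h0; push_cast; ring⟩
  · exact ⟨n, by push_cast; ring⟩

/-- The continuation of `∑' e^{nz} / (1 - θ⁻¹ q^n)`, the sum running over `n ∈ ℤ + l`. -/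
def twistedBase (θ τ : ℂ) (l : ℝ) (z : ℂ) : ℂ :=
  geomExpSum (leastPos l) θ⁻¹ τ z -
    θ * geomExpSum (1 - l) θ τ (-z + 2 * Real.pi * Complex.I * τ) +
    (if l = 0 ∧ θ ≠ 1 then (1 - θ⁻¹)⁻¹ else 0)

lemma differentiableOn_twistedBase {θ τ : ℂ} {l : ℝ} (hθ : ‖θ‖ = 1) (hτ : 0 < τ.im) (h0 : 0 ≤ l)
    (h1 : l < 1) : DifferentiableOn ℂ (twistedBase θ τ l) (periodLattice τ)ᶜ := by
  intro z hz
  apply DifferentiableAt.differentiableWithinAt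
  have hθ' : ‖θ⁻¹‖ = 1 := by rw [norm_inv, hθ, inv_one]
  have e1 : DifferentiableAt ℂ (geomExpSum (leastPos l) θ⁻¹ τ) z :=
    differentiableAt_geomExpSum (leastPos_pos h0) hθ' hτ fun j hj =>
      hz (mem_periodLattice_of_exp_eq_one (x := j) (by simpa using hj))
  have e2 : DifferentiableAt ℂ (geomExpSum (1 - l) θ τ) (-z + 2 * Real.pi * Complex.I * τ) := by
    refine differentiableAt_geomExpSum (by linarith) hθ hτ fun j hj => hz ?_
    refine mem_periodLattice_of_exp_eq_one (x := -(j + 1)) ?_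
    rw [← inv_inj, ← Complex.exp_neg, inv_one, ← hj]
    congr 1; push_cast; ring
  have e3 : DifferentiableAt ℂ (fun z => geomExpSum (1 - l) θ τ
      (-z + 2 * Real.pi * Complex.I * τ)) z :=
    DifferentiableAt.comp (f := fun z : ℂ => -z + 2 * Real.pi * Complex.I * τ) z e2 (by fun_prop)
  exact (e1.sub (e3.const_mul θ)).add_const _

/-- The coefficient of `e^{nz}` in the annulus `|q| < |e^z| < 1`. -/
def twistedTerm (θ τ : ℂ) (n : ℝ) : ℂ :=
  if n = 0 ∧ θ = 1 then 0 else (1 - θ⁻¹ * Complex.exp (2 * Real.pi * Complex.I * τ * n))⁻¹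

lemma inv_one_sub_inv {a : ℂ} (h0 : a ≠ 0) (h1 : a ≠ 1) : (1 - a⁻¹)⁻¹ = -(a / (1 - a)) := by
  have h2 : 1 - a ≠ 0 := sub_ne_zero.mpr h1.symm
  have h3 : a - 1 ≠ 0 := sub_ne_zero.mpr h1
  rw [inv_eq_iff_eq_inv]; field_simp; ring

open Complex in
-- For `n < 0`, `1 / (1 - θ⁻¹ qⁿ) = -θ q^|n| / (1 - θ q^|n|)`. The negative half is thus again a
-- `geomExpSum`, evaluated at `-z + 2πiτ`, which has negative real part exactly when `|q| < |e^z|`.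
lemma hasSum_twistedBase {θ τ : ℂ} {l : ℝ} (hθ : ‖θ‖ = 1) (hτ : 0 < τ.im) (h0 : 0 ≤ l)
    (h1 : l < 1) (z : ℂ) (hz : -(2 * Real.pi * τ.im) < z.re) (hz' : z.re < 0) :
    HasSum (fun m : ℤ => twistedTerm θ τ (m + l : ℝ) * exp ((m + l : ℝ) * z))
      (twistedBase θ τ l z) := by
  have hθ0 : θ ≠ 0 := by rintro rfl; simp at hθ
  have hθ' : ‖θ⁻¹‖ = 1 := by rw [norm_inv, hθ, inv_one]
  have hpos := hasSum_geomExpSum_fiber (leastPos_pos h0) hθ' hτ hz'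
  have hneg := (hasSum_geomExpSum_fiber (μ := 1 - l) (by linarith) hθ hτ
    (z := -z + 2 * Real.pi * I * τ) (by simp; linarith)).mul_left (-θ)
  have key : HasSum (fun m : ℕ => twistedTerm θ τ ((m : ℤ) + l : ℝ) * exp (((m : ℤ) + l : ℝ) * z))
      (geomExpSum (leastPos l) θ⁻¹ τ z + (if l = 0 ∧ θ ≠ 1 then (1 - θ⁻¹)⁻¹ else 0)) := by
    by_cases hl : l = 0
    · subst hl
      have := (hasSum_nat_add_iff (f := fun m : ℕ => twistedTerm θ τ ((m : ℤ) + (0:ℝ) : ℝ) *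
        exp (((m : ℤ) + (0 : ℝ) : ℝ) * z)) 1 (g := geomExpSum (leastPos 0) θ⁻¹ τ z)).mp (by
          refine hpos.congr_terms fun m => ?_
          have : ((m + 1 : ℕ) : ℤ) + (0 : ℝ) = leastPos 0 + m := by
            simp [leastPos]; ring
          rw [this, twistedTerm, if_neg, mul_comm, div_eq_mul_inv]
          rintro ⟨h, -⟩
          have := leastPos_pos (le_refl 0)
          have : (0 : ℝ) < leastPos 0 + m := by positivity
          linarith)
      rw [Finset.sum_range_one] at this
      have e : twistedTerm θ τ ((((0 : ℕ) : ℤ) : ℝ) + 0) * exp (((((0 : ℕ) : ℤ) : ℝ) + 0 : ℝ) * z) =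
          if (0 : ℝ) = 0 ∧ θ ≠ 1 then (1 - θ⁻¹)⁻¹ else 0 := by
        simp [twistedTerm, ite_not]
      rw [← e]
      exact this
    · rw [if_neg (by tauto), add_zero]
      refine hpos.congr_terms fun m => ?_
      have : ((m : ℤ) + l : ℝ) = leastPos l + m := by simp [leastPos, hl]; ring
      rw [this, twistedTerm, if_neg, mul_comm, div_eq_mul_inv]
      rintro ⟨h, -⟩
      have := leastPos_pos h0
      have : (0 : ℝ) < leastPos l + m := by positivity
      linarith
  have := HasSum.of_nat_of_neg_add_one
    (f := fun m : ℤ => twistedTerm θ τ (m + l : ℝ) * exp ((m + l : ℝ) * z)) key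
    (m' := -θ * geomExpSum (1 - l) θ τ (-z + 2 * Real.pi * I * τ)) (by
    refine hneg.congr_terms fun m => ?_
    have e : ((-((m : ℤ) + 1) : ℤ) + l : ℝ) = -(1 - l + m) := by push_cast; ring
    have hn : 0 < 1 - l + m := by
      have : (0 : ℝ) ≤ m := Nat.cast_nonneg m
      linarith
    rw [e, twistedTerm, if_neg (by rintro ⟨h, -⟩; linarith)]
    generalize 1 - l + (m : ℝ) = n at hn ⊢
    have e2 : θ⁻¹ * exp (2 * Real.pi * I * τ * ((-n : ℝ) : ℂ)) =
        (θ * exp (2 * Real.pi * I * τ * n))⁻¹ := by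
      rw [mul_inv, ← exp_neg]; congr 2; push_cast; ring
    rw [e2, inv_one_sub_inv (mul_ne_zero hθ0 (exp_ne_zero _))]
    · rw [mul_add, exp_add]
      have : ((n : ℂ)) * -z = ((-n : ℝ) : ℂ) * z := by push_cast; ring
      rw [this, show (n : ℂ) * (2 * Real.pi * I * τ) = 2 * Real.pi * I * τ * n by ring]
      ring
    · intro h
      have := congrArg norm h
      rw [norm_mul, hθ, one_mul, norm_exp, norm_one, Real.exp_eq_one_iff, re_mul_ofReal] at this
      have h3 : 0 < 2 * Real.pi * τ.im * n := by positivity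
      have h4 : (2 * Real.pi * I * τ).re = -(2 * Real.pi * τ.im) := by simp
      rw [h4] at this
      linarith)
  rw [twistedBase, sub_eq_add_neg, add_right_comm, ← neg_mul]
  exact this

/-- The coefficient of `e^{nz} q^{|n| j}` in the annulus `1 < |e^z| < |q|⁻¹`. -/
def outerCoeff (θ : ℂ) (n : ℝ) (j : ℕ) : ℂ :=
  if n < 0 then -θ ^ j
  else if 0 < n then (if j = 0 then 0 else (θ⁻¹) ^ j)
  else if j = 0 then (if θ = 1 then -1 else -(1 - θ)⁻¹) else 0

/-- The two sides continue `∑ e^{nz}` over `n > 0` and `-∑ e^{nz}` over `n ≤ 0`, `n ∈ ℤ + l`: one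
function expanded on either side of `Re z = 0`. The correction is the term `n = 0`. -/
lemma geomExp_leastPos {l : ℝ} {z : ℂ} (hz : Complex.exp z ≠ 1) :
    geomExp (leastPos l) z = -geomExp (1 - l) (-z) - if l = 0 then 1 else 0 := by
  have h1 : 1 - Complex.exp z ≠ 0 := sub_ne_zero.mpr hz.symm
  have h2 : Complex.exp z - 1 ≠ 0 := sub_ne_zero.mpr hz
  have e : 1 - Complex.exp (-z) = (Complex.exp z - 1) / Complex.exp z := by
    rw [Complex.exp_neg]; field_simp [Complex.exp_ne_zero]
  have e2 : geomExp (1 - l) (-z) = Complex.exp (l * z) / (Complex.exp z - 1) := by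
    rw [geomExp, e, div_div_eq_mul_div, ← Complex.exp_add]
    congr 2; push_cast; ring
  rw [e2]
  unfold leastPos geomExp
  split_ifs with h0
  · subst h0
    simp; field_simp; ring
  · field_simp; ring

open Complex in
lemma hasSum_twistedBase_outer {θ τ φ : ℂ} (hθ : ‖θ‖ = 1) (hτ : 0 < τ.im) (hφ : ‖φ‖ = 1)
    (z : ℂ) (hz : 0 < z.re) (hz' : z.re < 2 * Real.pi * τ.im) :
    HasSum (fun s : ℝ × ℕ => (if exp (2 * Real.pi * I * s.1) = φ then outerCoeff θ s.1 s.2 *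
        exp (2 * Real.pi * I * τ * (|s.1| * s.2)) else 0) * exp (s.1 * z))
      (twistedBase θ τ (twistExponent φ) z) := by
  set l := twistExponent φ with hl
  have h0 : 0 ≤ l := twistExponent_nonneg φ
  have h1 : l < 1 := twistExponent_lt_one φ
  have hθ0 : θ ≠ 0 := by rintro rfl; simp at hθ
  have hθ' : ‖θ⁻¹‖ = 1 := by rw [norm_inv, hθ, inv_one]
  have hiff := exp_eq_iff_twistExponent hφ
  rw [← hl] at hiff
  set f := fun s : ℝ × ℕ => (if exp (2 * Real.pi * I * s.1) = φ then outerCoeff θ s.1 s.2 *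
        exp (2 * Real.pi * I * τ * (|s.1| * s.2)) else 0) * exp (s.1 * z) with hf
  have hpos : HasSum (fun s : ℝ × ℕ => if 0 < s.1 then f s else 0)
      (θ⁻¹ * geomExpSum (leastPos l) θ⁻¹ τ (z + 2 * Real.pi * I * τ)) := by
    -- For `Re z > 0` the layer `j = 0` of positive exponents diverges, so here `j` starts at `1`.
    have hinj : Function.Injective fun s : ℕ × ℕ => (leastPos l + (s.1 : ℝ), s.2 + 1) := by
      rintro ⟨a, b⟩ ⟨c, d⟩ h
      simpa using h
    refine (hinj.hasSum_iff ?_).mp (((hasSum_geomExpSum (leastPos_pos h0) hθ' hτ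
      (z := z + 2 * Real.pi * I * τ) (by simp; linarith)).mul_left θ⁻¹).congr_terms ?_)
    · rintro ⟨x, j⟩ hx
      by_contra hne
      have hx0 : 0 < x := by by_contra h; simp [h] at hne
      have hxφ : exp (2 * Real.pi * I * x) = φ := by
        by_contra h; simp [hf, h] at hne
      have hj : j ≠ 0 := by
        rintro rfl
        simp [hf, outerCoeff, hx0, hx0.not_gt] at hne
      obtain ⟨m, rfl⟩ := (hiff x).mp hxφ
      obtain ⟨n, hn⟩ := exists_nat_leastPos h1 m hx0
      obtain ⟨i, rfl⟩ := Nat.exists_eq_succ_of_ne_zero hj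
      exact hx ⟨(n, i), by simp [hn]⟩
    · rintro ⟨a, j⟩
      have hn : 0 < leastPos l + a := by have := leastPos_pos h0; positivity
      have hm : exp (2 * Real.pi * I * (leastPos l + a : ℝ)) = φ :=
        (hiff _).mpr (leastPos_add_nat l a)
      simp only [Function.comp, hf, if_pos hn, if_pos hm, outerCoeff, hn.not_gt, if_false,
        abs_of_pos hn, Nat.succ_ne_zero]
      rw [mul_assoc, ← exp_add, pow_succ', mul_assoc]
      congr 3
      push_cast; ring
  have hneg : HasSum (fun s : ℝ × ℕ => if s.1 < 0 then f s else 0)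
      (-geomExpSum (1 - l) θ τ (-z)) := by
    have hinj : Function.Injective fun s : ℕ × ℕ => (-((1 - l) + (s.1 : ℝ)), s.2) := by
      rintro ⟨a, b⟩ ⟨c, d⟩ h
      simpa using h
    refine (hinj.hasSum_iff ?_).mp (((hasSum_geomExpSum (μ := 1 - l) (by linarith) hθ hτ
      (z := -z) (by simp; linarith)).neg).congr_terms ?_)
    · rintro ⟨x, j⟩ hx
      by_contra hne
      have hx0 : x < 0 := by by_contra h; simp [h] at hne
      have hxφ : exp (2 * Real.pi * I * x) = φ := by
        by_contra h; simp [hf, h] at hne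
      obtain ⟨m, rfl⟩ := (hiff x).mp hxφ
      obtain ⟨n, hn⟩ := exists_nat_neg h0 m hx0
      exact hx ⟨(n, j), by simp [hn]⟩
    · rintro ⟨a, j⟩
      have ha : 0 < 1 - l + a := by
        have : (0 : ℝ) ≤ a := Nat.cast_nonneg a
        linarith
      have hn : -(1 - l + a) < 0 := by linarith
      have hm : exp (2 * Real.pi * I * (-(1 - l + a) : ℝ)) = φ :=
        (hiff _).mpr ⟨-(a + 1), by push_cast; ring⟩
      simp only [Function.comp, hf, if_pos hn, if_pos hm, outerCoeff, abs_of_neg hn]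
      rw [neg_mul, neg_mul, mul_assoc, ← exp_add]
      congr 3
      push_cast; ring
  have hzero : HasSum (fun s : ℝ × ℕ => if s.1 = 0 then f s else 0)
      (if l = 0 then (if θ = 1 then -1 else -(1 - θ)⁻¹) else 0) := by
    have : (if (0 : ℝ) = 0 then f (0, 0) else 0) =
        (if l = 0 then (if θ = 1 then -1 else -(1 - θ)⁻¹) else 0) := by
      have : (1 = φ) ↔ l = 0 := by
        have := hiff 0
        simp only [ofReal_zero, mul_zero, exp_zero] at this
        rw [this]
        constructor
        · rintro ⟨m, hm⟩
          have e1 : (m : ℝ) ≤ 0 := by linarith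
          have e2 : (-1 : ℝ) < m := by linarith
          have e1' : m ≤ 0 := by exact_mod_cast e1
          have e2' : -1 < m := by exact_mod_cast e2
          have : m = 0 := by omega
          subst this; simpa using hm.symm
        · intro h; exact ⟨0, by simp [h]⟩
      simp [hf, outerCoeff, this]
    rw [← this]
    refine hasSum_single (f := fun s : ℝ × ℕ => if s.1 = 0 then f s else 0) (0, 0) ?_
    rintro ⟨x, j⟩ hne
    by_cases hx : x = 0
    · subst hx
      have : j ≠ 0 := by rintro rfl; exact hne rfl
      simp [hf, outerCoeff, this]
    · simp [hx]
  have htot := (hpos.add hneg).add hzero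
  have hez : exp z ≠ 1 := by
    intro h
    have := congrArg norm h
    rw [norm_exp, norm_one, Real.exp_eq_one_iff] at this
    linarith
  -- Splitting off the layer `j = 0` on both halves, the two `geomExp` terms cancel up to `-1` when
  -- `l = 0`. For `θ ≠ 1` this `-1` combines with `(1 - θ⁻¹)⁻¹` to `-(1 - θ)⁻¹`.
  have hval : twistedBase θ τ l z = θ⁻¹ * geomExpSum (leastPos l) θ⁻¹ τ (z + 2 * Real.pi * I * τ) +
      -geomExpSum (1 - l) θ τ (-z) + (if l = 0 then (if θ = 1 then -1 else -(1 - θ)⁻¹) else 0) := by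
    rw [twistedBase, geomExpSum_eq_add (leastPos_pos h0) hθ' hτ z,
      geomExpSum_eq_add (μ := 1 - l) (by linarith) hθ hτ (-z), geomExp_leastPos hez]
    by_cases hl0 : l = 0
    · by_cases ht : θ = 1
      · simp [hl0, ht]; ring
      · simp only [hl0, ht, if_true, if_false, ne_eq, not_false_eq_true, and_self]
        rw [inv_one_sub_inv hθ0 ht]
        have h2 : 1 - θ ≠ 0 := sub_ne_zero.mpr (Ne.symm ht)
        field_simp
        ring
    · simp only [hl0, if_false, false_and]; ring
  rw [hval]
  refine htot.congr_terms fun s => ?_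
  rcases lt_trichotomy s.1 0 with h | h | h
  · simp [h, h.not_gt, h.ne]
  · simp [h]
  · simp [h, h.not_gt, h.ne']

/-- The continuation of the twisted Weierstrass series. -/
def twistedCont (k : ℕ) (θ φ τ : ℂ) (z : ℂ) : ℂ :=
  (-1) ^ k / ((k - 1).factorial : ℂ) * iteratedDeriv (k - 1) (twistedBase θ τ (twistExponent φ)) z

open Complex in
lemma isTwistedWeierstrass_twistedCont (k : ℕ) {θ φ τ : ℂ} (hθ : ‖θ‖ = 1) (hτ : 0 < τ.im) :
    IsTwistedWeierstrass k θ φ τ (twistedCont k θ φ τ) := by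
  have h0 := twistExponent_nonneg φ
  have h1 := twistExponent_lt_one φ
  refine ⟨((differentiableOn_twistedBase hθ hτ h0 h1).iteratedDeriv_of_isOpen
    (isClosed_periodLattice hτ).isOpen_compl _).const_mul _, fun z hz hz' => ?_⟩
  rw [norm_nome, norm_exp, Real.exp_lt_exp] at hz
  rw [norm_exp, Real.exp_lt_one_iff] at hz'
  have := hasSum_iteratedDeriv_exp (hasSum_twistedBase hθ hτ h0 h1) (k - 1) z hz hz'
  rw [twistedCont, twistedSeries, ← this.tsum_eq]
  congr 2
  funext m
  simp only [twistedTerm]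
  push_cast
  split_ifs <;> ring

lemma twistedP_eq_twistedCont (k : ℕ) {θ φ τ z : ℂ} (hθ : ‖θ‖ = 1) (hτ : 0 < τ.im)
    (hz : z ∉ periodLattice τ) : twistedP k θ φ z τ = twistedCont k θ φ τ z := by
  have h := isTwistedWeierstrass_twistedCont k (φ := φ) hθ hτ
  exact (Classical.epsilon_spec (p := IsTwistedWeierstrass k θ φ τ) ⟨_, h⟩).eqOn hτ h hz

open Complex in
lemma hasSum_twistedPCoeff (k : ℕ) {θ φ τ z : ℂ} (hθ : ‖θ‖ = 1) (hφ : ‖φ‖ = 1) (hτ : 0 < τ.im)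
    (hz : 1 < ‖exp z‖) (hz' : ‖nome τ‖ * ‖exp z‖ < 1) :
    HasSum (fun s : ℝ × ℕ => twistedPCoeff k θ φ s.1 s.2 * exp (s.1 * z) *
        exp (2 * Real.pi * I * τ * (|s.1| * s.2)))
      (twistedP k θ φ z τ) := by
  rw [norm_exp, Real.one_lt_exp_iff] at hz
  rw [norm_nome, norm_exp, ← Real.exp_add, Real.exp_lt_one_iff] at hz'
  rw [twistedP_eq_twistedCont k hθ hτ (notMem_periodLattice hτ 0 (by simpa using hz)
    (by simp; linarith))]
  have := (hasSum_iteratedDeriv_exp (fun z => hasSum_twistedBase_outer hθ hτ hφ z) (k - 1) z hz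
    (by linarith)).mul_left ((-1) ^ k / ((k - 1).factorial : ℂ))
  refine this.congr_terms fun s => ?_
  rw [twistedPCoeff]
  change (if _ then _ * _ * outerCoeff θ s.1 s.2 else _) * _ * _ = _
  split_ifs <;> ring

/-! ### Parity signs -/

lemma paritySign_zero : paritySign 0 = 1 := if_pos rfl

lemma paritySign_one : paritySign 1 = -1 := if_neg (by decide)

lemma paritySign_add (α β : ZMod 2) : paritySign (α + β) = paritySign α * paritySign β := by
  have h : ∀ γ : ZMod 2, γ = 0 ∨ γ = 1 := by decide
  rcases h α with rfl | rfl <;> rcases h β with rfl | rfl <;>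
    simp [paritySign, show (1 : ZMod 2) + 1 = 0 from rfl]

lemma paritySign_mul_self (α : ZMod 2) : paritySign α * paritySign α = 1 := by
  rw [← paritySign_add, CharTwo.add_self_eq_zero, paritySign_zero]

lemma exists_parity_decomposition {E : Type*} [AddCommGroup E] [Module ℂ E] {σ : E →ₗ[ℂ] E}
    (hσ : ∀ a, σ (σ a) = a) (w : E) :
    ∃ w₀ w₁ : E, w = w₀ + w₁ ∧ σ w₀ = paritySign 0 • w₀ ∧ σ w₁ = paritySign 1 • w₁ := by
  refine ⟨(2⁻¹ : ℂ) • (w + σ w), (2⁻¹ : ℂ) • (w - σ w), ?_, ?_, ?_⟩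
  · module
  · simp only [map_smul, map_add, hσ, paritySign_zero]; module
  · simp only [map_smul, map_sub, hσ, paritySign_one]; module

/-! ### Shift operators on mode indices and Dong's lemma -/

section Shift

variable {Γ R : Type*} [AddCommGroup Γ] [AddCommGroup R] [Module ℂ R]

/-- Translation of functions by `e`. -/
def shiftBy (e : Γ) : Module.End ℂ (Γ → R) := LinearMap.funLeft ℂ R (fun γ => γ + e)

lemma shiftBy_apply (e : Γ) (f : Γ → R) (γ : Γ) : shiftBy e f γ = f (γ + e) := rfl

lemma commute_shiftBy (e e' : Γ) : Commute (shiftBy e : Module.End ℂ (Γ → R)) (shiftBy e') := by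
  refine LinearMap.ext fun f => funext fun γ => ?_
  simp only [Module.End.mul_apply, shiftBy_apply, add_right_comm]

lemma shiftBy_pow_apply (e : Γ) (k : ℕ) (f : Γ → R) (γ : Γ) :
    ((shiftBy e) ^ k) f γ = f (γ + k • e) := by
  induction k generalizing γ with
  | zero => simp
  | succ k ih => rw [pow_succ', Module.End.mul_apply, shiftBy_apply, ih, succ_nsmul']; abel_nf

variable (R) in
/-- The difference of two translations. -/
def shiftDiff (e e' : Γ) : Module.End ℂ (Γ → R) := shiftBy e - shiftBy e'

lemma shiftDiff_pow_apply (e e' : Γ) (N : ℕ) (f : Γ → R) (γ : Γ) :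
    (shiftDiff R e e' ^ N) f γ = ∑ j ∈ Finset.range (N + 1),
      ((-1 : ℂ) ^ j * (N.choose j : ℂ)) • f (γ + (N - j) • e + j • e') := by
  have hc : Commute ((-1 : ℂ) • shiftBy e' : Module.End ℂ (Γ → R)) (shiftBy e) :=
    (commute_shiftBy e' e).smul_left _
  have h : shiftDiff R e e' = (-1 : ℂ) • shiftBy e' + shiftBy e := by rw [shiftDiff]; module
  rw [h, hc.add_pow, LinearMap.sum_apply, Finset.sum_apply]
  refine Finset.sum_congr rfl fun j _ => ?_
  rw [smul_pow, ← Nat.cast_comm, ← nsmul_eq_mul, LinearMap.smul_apply, Pi.smul_apply,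
    Module.End.mul_apply, LinearMap.smul_apply, Pi.smul_apply, shiftBy_pow_apply,
    shiftBy_pow_apply, add_right_comm, mul_comm, mul_smul, Nat.cast_smul_eq_nsmul]

end Shift

lemma pow_apply_eq_zero_of_le {W : Type*} [AddCommGroup W] [Module ℂ W] {p : Module.End ℂ W} {F : W}
    {a b : ℕ} (h : (p ^ a) F = 0) (hab : a ≤ b) : (p ^ b) F = 0 := by
  obtain ⟨c, rfl⟩ := Nat.exists_eq_add_of_le' hab
  rw [pow_add, Module.End.mul_apply, h, map_zero]

lemma add_pow_apply_eq_zero {W : Type*} [AddCommGroup W] [Module ℂ W] {p q : Module.End ℂ W}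
    (hpq : Commute p q) {F : W} {a b : ℕ} (h1 : (p ^ a) F = 0) (h2 : (q ^ b) F = 0) :
    ((p + q) ^ (a + b)) F = 0 := by
  rw [hpq.add_pow, LinearMap.sum_apply]
  refine Finset.sum_eq_zero fun j _ => ?_
  rw [← Nat.cast_comm, ← nsmul_eq_mul, LinearMap.smul_apply]
  rcases le_total a j with h | h
  · rw [(hpq.pow_pow j (a + b - j)).eq, Module.End.mul_apply, pow_apply_eq_zero_of_le h1 h, map_zero,
      smul_zero]
  · rw [Module.End.mul_apply, pow_apply_eq_zero_of_le h2 (by omega), map_zero, smul_zero]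

lemma pow_apply_comm_eq_zero {W : Type*} [AddCommGroup W] [Module ℂ W] {p q : Module.End ℂ W}
    (hpq : Commute p q) {F : W} {a b : ℕ} (h : (p ^ a) F = 0) : (p ^ a) ((q ^ b) F) = 0 := by
  rw [← Module.End.mul_apply, (hpq.pow_pow a b).eq, Module.End.mul_apply, h, map_zero]

section Dong

variable {R : Type*} [Ring R] [Algebra ℂ R]

/-- `(x - y)^N (A(x) B(y) - s B(y) A(x)) = 0`, coefficient by coefficient. -/
def LocalOfOrder (N : ℕ) (s : ℂ) (A B : ℤ → R) : Prop :=
  ∀ m n : ℤ, ∑ j ∈ Finset.range (N + 1), ((-1 : ℂ) ^ j * (N.choose j : ℂ)) •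
    (A (m + N - j) * B (n + j) - s • (B (n + j) * A (m + N - j))) = 0

/-- The three mode indices. -/
abbrev idx₁ : ℤ × ℤ × ℤ := (1, 0, 0)
/-- The three mode indices. -/
abbrev idx₂ : ℤ × ℤ × ℤ := (0, 1, 0)
/-- The three mode indices. -/
abbrev idx₃ : ℤ × ℤ × ℤ := (0, 0, 1)

lemma commute_shift_sub (e₁ e₂ e₃ e₄ : ℤ × ℤ × ℤ) :
    Commute (shiftDiff R e₁ e₂) (shiftDiff R e₃ e₄) :=
  ((commute_shiftBy _ _).sub_left (commute_shiftBy _ _)).sub_right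
    ((commute_shiftBy _ _).sub_left (commute_shiftBy _ _))

/-- Dong's lemma for the modes `[A(l), B(x)]`, with `A` even. -/
lemma exists_shift_pow_eq_zero {A B C : ℤ → R} {s : ℂ} {N₁ N₂ N₃ : ℕ} (hAB : LocalOfOrder N₁ 1 A B)
    (hBC : LocalOfOrder N₂ s B C) (hAC : LocalOfOrder N₃ 1 A C) :
    (shiftDiff R idx₂ idx₃ ^ (N₁ + N₃ + N₂)) (fun x : ℤ × ℤ × ℤ =>
      (A x.1 * B x.2.1 - B x.2.1 * A x.1) * C x.2.2 -
        s • (C x.2.2 * (A x.1 * B x.2.1 - B x.2.1 * A x.1))) = 0 := by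
  set F₁ : ℤ × ℤ × ℤ → R := fun x => A x.1 * (B x.2.1 * C x.2.2 - s • (C x.2.2 * B x.2.1)) -
    (B x.2.1 * C x.2.2 - s • (C x.2.2 * B x.2.1)) * A x.1 with hF₁
  set F₂ : ℤ × ℤ × ℤ → R := fun x => B x.2.1 * (A x.1 * C x.2.2 - C x.2.2 * A x.1) -
    s • ((A x.1 * C x.2.2 - C x.2.2 * A x.1) * B x.2.1) with hF₂
  set F : ℤ × ℤ × ℤ → R := fun x : ℤ × ℤ × ℤ =>
      (A x.1 * B x.2.1 - B x.2.1 * A x.1) * C x.2.2 -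
        s • (C x.2.2 * (A x.1 * B x.2.1 - B x.2.1 * A x.1)) with hF
  -- The Jacobi identity `[[A, B], C] = [A, [B, C]] - [B, [A, C]]`, with sign `s` for the exchange
  -- of `B` and `C`.
  have hsplit : F = F₁ - F₂ := by
    funext x
    simp only [hF, hF₁, hF₂, Pi.sub_apply, mul_sub, sub_mul, smul_sub, mul_smul_comm,
      smul_mul_assoc, mul_assoc]
    abel
  have h1 : (shiftDiff R idx₁ idx₂ ^ N₁) F = 0 := by
    funext ⟨l, m, n⟩
    rw [shiftDiff_pow_apply]
    have h := hAB l m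
    have h' := congrArg (fun X => X * C n - s • (C n * X)) h
    simp only [zero_mul, mul_zero, smul_zero, sub_zero, Finset.sum_mul, Finset.mul_sum,
      Finset.smul_sum, ← Finset.sum_sub_distrib] at h'
    rw [Pi.zero_apply, ← h']
    refine Finset.sum_congr rfl fun j hj => ?_
    have hj : j ≤ N₁ := Nat.lt_succ_iff.mp (Finset.mem_range.mp hj)
    have e : l + ((N₁ - j : ℕ) : ℤ) = l + N₁ - j := by omega
    simp only [hF, Prod.mk_add_mk, Prod.smul_mk, smul_zero, add_zero, nsmul_one, e, one_smul,
      smul_mul_assoc, mul_smul_comm, smul_comm s, smul_sub, mul_sub, sub_mul]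
  have h2 : (shiftDiff R idx₂ idx₃ ^ N₂) F₁ = 0 := by
    funext ⟨l, m, n⟩
    rw [shiftDiff_pow_apply]
    have h := hBC m n
    have h' := congrArg (fun X => A l * X - X * A l) h
    simp only [zero_mul, mul_zero, sub_zero, Finset.sum_mul, Finset.mul_sum,
      ← Finset.sum_sub_distrib] at h'
    rw [Pi.zero_apply, ← h']
    refine Finset.sum_congr rfl fun j hj => ?_
    have hj : j ≤ N₂ := Nat.lt_succ_iff.mp (Finset.mem_range.mp hj)
    have e : m + ((N₂ - j : ℕ) : ℤ) = m + N₂ - j := by omega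
    simp only [hF₁, Prod.mk_add_mk, Prod.smul_mk, smul_zero, add_zero, nsmul_one, e,
      smul_mul_assoc, mul_smul_comm, smul_sub, mul_sub, sub_mul]
  have h3 : (shiftDiff R idx₁ idx₃ ^ N₃) F₂ = 0 := by
    funext ⟨l, m, n⟩
    rw [shiftDiff_pow_apply]
    have h := hAC l n
    have h' := congrArg (fun X => B m * X - s • (X * B m)) h
    simp only [zero_mul, mul_zero, smul_zero, sub_zero, Finset.sum_mul, Finset.mul_sum,
      Finset.smul_sum, ← Finset.sum_sub_distrib] at h'
    rw [Pi.zero_apply, ← h']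
    refine Finset.sum_congr rfl fun j hj => ?_
    have hj : j ≤ N₃ := Nat.lt_succ_iff.mp (Finset.mem_range.mp hj)
    have e : l + ((N₃ - j : ℕ) : ℤ) = l + N₃ - j := by omega
    simp only [hF₂, Prod.mk_add_mk, Prod.smul_mk, smul_zero, add_zero, nsmul_one, e, one_smul,
      smul_mul_assoc, mul_smul_comm, smul_comm s, smul_sub, mul_sub, sub_mul]
  set q := shiftDiff R idx₂ idx₃ with hq
  -- This is `y - w = (y - x) + (x - w)`. The factor `q ^ N₂` kills `F₁` and leaves `-F₂`; in the
  -- expansion of `q ^ (N₁ + N₃)` every term contains a power of `y - x` that kills `F` or a power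
  -- of `x - w` that kills `F₂`.
  have e : q = shiftDiff R idx₂ idx₁ + shiftDiff R idx₁ idx₃ := by
    rw [hq, shiftDiff, shiftDiff, shiftDiff]; abel
  have hp : (shiftDiff R idx₂ idx₁ ^ N₁) F = 0 := by
    rw [show shiftDiff R idx₂ idx₁ = -shiftDiff R idx₁ idx₂ from (neg_sub _ _).symm,
      ← neg_one_smul ℂ, smul_pow, LinearMap.smul_apply, h1, smul_zero]
  rw [pow_add, Module.End.mul_apply]
  conv_lhs => enter [1, 1]; rw [e]
  refine add_pow_apply_eq_zero (commute_shift_sub _ _ _ _)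
    (pow_apply_comm_eq_zero (commute_shift_sub _ _ _ _) hp) ?_
  rw [hsplit, map_sub, h2, zero_sub, map_neg,
    pow_apply_comm_eq_zero (commute_shift_sub _ _ _ _) h3, neg_zero]

/-- Multiplication by the second index. -/
def mulIndex : Module.End ℂ (ℤ × ℤ × ℤ → R) where
  toFun f x := (x.2.1 : ℂ) • f x
  map_add' f g := by funext x; simp
  map_smul' c f := by funext x; simp [smul_comm c]

/-- A Leibniz rule: multiplication by a mode index plays the role of a derivative of the field, so
it preserves locality at the cost of one more factor `y - w`. -/
lemma shift_pow_mulIndex (k : ℕ) (f : ℤ × ℤ × ℤ → R) :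
    (shiftDiff R idx₂ idx₃ ^ (k + 1)) (mulIndex f) =
      mulIndex ((shiftDiff R idx₂ idx₃ ^ (k + 1)) f) +
        ((k + 1 : ℕ) : ℂ) • shiftBy idx₂ ((shiftDiff R idx₂ idx₃ ^ k) f) := by
  have base : ∀ f : ℤ × ℤ × ℤ → R, shiftDiff R idx₂ idx₃ (mulIndex f) =
      mulIndex (shiftDiff R idx₂ idx₃ f) + shiftBy idx₂ f := by
    intro f
    funext ⟨l, m, n⟩
    simp only [shiftDiff, LinearMap.sub_apply, Pi.sub_apply, Pi.add_apply, shiftBy_apply, mulIndex,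
      LinearMap.coe_mk, AddHom.coe_mk, Prod.mk_add_mk, add_zero]
    push_cast
    module
  have hc : ∀ g : ℤ × ℤ × ℤ → R, shiftDiff R idx₂ idx₃ (shiftBy idx₂ g) =
      shiftBy idx₂ (shiftDiff R idx₂ idx₃ g) := fun g =>
    LinearMap.congr_fun ((Commute.refl _).sub_left (commute_shiftBy _ _)).eq g
  induction k with
  | zero => simp [base]
  | succ k ih =>
    have hs : ∀ i, (shiftDiff R idx₂ idx₃) ((shiftDiff R idx₂ idx₃ ^ i) f) =
        (shiftDiff R idx₂ idx₃ ^ (i + 1)) f := fun i => by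
      rw [pow_succ' _ i, Module.End.mul_apply]
    rw [pow_succ', Module.End.mul_apply, ih, map_add, base, map_smul, hc, hs, hs,
      Module.End.mul_apply, hs]
    push_cast
    module

end Dong

/-! ### Weights of modes in the superalgebra -/

namespace VOSA

variable {V : Type*} [AddCommGroup V] [Module ℂ V] (𝒱 : VOSA V)

lemma mem_weightSpace {r : ℝ} {a : V} : a ∈ 𝒱.weightSpace r ↔ 𝒱.Y 𝒱.ω 1 a = (r : ℂ) • a :=
  Module.End.mem_eigenspace_iff

lemma hasParity_ω : 𝒱.HasParity 0 𝒱.ω := by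
  rw [HasParity, paritySign_zero, one_smul, 𝒱.σ_ω]

lemma exists_localOfOrder {α β : ZMod 2} {a b : V} (ha : 𝒱.HasParity α a) (hb : 𝒱.HasParity β b) :
    ∃ N, LocalOfOrder N (paritySign (α * β)) (𝒱.Y a) (𝒱.Y b) :=
  𝒱.locality α β a b ha hb

lemma translate_mem_weightSpace {r : ℝ} {a : V} (ha : a ∈ 𝒱.weightSpace r) :
    𝒱.Y 𝒱.ω 0 a ∈ 𝒱.weightSpace (r + 1) := by
  rw [mem_weightSpace] at ha ⊢
  have h := LinearMap.congr_fun (𝒱.virasoro 0 (-1)) a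
  simp only [LinearMap.sub_apply, Module.End.mul_apply, zero_add, LinearMap.add_apply,
    LinearMap.smul_apply, neg_add_cancel, ha, map_smul] at h
  norm_num at h
  rw [sub_eq_iff_eq_add] at h
  rw [h]
  push_cast
  module

/-- The vector `a(-1-k)𝟏` is a multiple of `L(-1)^k a`, and each `L(-1)` raises the weight by one;
the induction passes from `a` to `L(-1)a`. -/
lemma ω_one_mode_vac (a : V) (wt : ℝ) (ha : a ∈ 𝒱.weightSpace wt) (n : ℤ) :
    𝒱.Y 𝒱.ω 1 (𝒱.Y a n 𝒱.vac) = ((wt : ℂ) - n - 1) • 𝒱.Y a n 𝒱.vac := by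
  rcases le_or_gt 0 n with hn | hn
  · rw [𝒱.creation a n (by omega), if_neg (by omega)]; simp
  · obtain ⟨k, rfl⟩ : ∃ k : ℕ, n = -1 - k := ⟨(-1 - n).toNat, by omega⟩
    clear hn
    induction k generalizing a wt with
    | zero =>
      have := 𝒱.creation a (-1) le_rfl
      simp only [if_true] at this
      simp only [Nat.cast_zero, sub_zero, this]
      rw [(𝒱.mem_weightSpace).mp ha]; push_cast; congr 1; ring
    | succ k ih =>
      have h := ih _ _ (𝒱.translate_mem_weightSpace ha)
      rw [𝒱.translation] at h
      have e : (-1 - (k : ℤ) - 1) = -1 - ((k + 1 : ℕ) : ℤ) := by push_cast; ring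
      have hne : -(((-1 - k : ℤ)) : ℂ) ≠ 0 := by
        have : (-1 - (k : ℤ)) ≠ 0 := by omega
        exact neg_ne_zero.mpr ((Int.cast_ne_zero (α := ℂ)).mpr this)
      rw [e, LinearMap.smul_apply, map_smul, smul_comm] at h
      have := smul_right_injective V hne h
      rw [this]
      congr 1; push_cast; ring

/-- Goddard uniqueness: the defect `D m = [L(0), a(m)] - (wt - m - 1) a(m)` kills the vacuum, and it
is local with every homogeneous-parity field by Dong's lemma. Such a field vanishes, because every
vector `c` is created from the vacuum by `c(-1)`. -/
lemma mode_mem_weightSpace {a b : V} {wt s : ℝ} {α : ZMod 2} (ha : a ∈ 𝒱.weightSpace wt)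
    (hα : 𝒱.HasParity α a) (hb : b ∈ 𝒱.weightSpace s) (n : ℤ) :
    𝒱.Y a n b ∈ 𝒱.weightSpace (wt + s - n - 1) := by
  set D : ℤ → Module.End ℂ V := fun m => 𝒱.Y 𝒱.ω 1 * 𝒱.Y a m - 𝒱.Y a m * 𝒱.Y 𝒱.ω 1 +
    ((m : ℂ) + 1 - wt) • 𝒱.Y a m with hD
  have hvac : ∀ m, D m 𝒱.vac = 0 := by
    intro m
    have h := 𝒱.ω_one_mode_vac a wt ha m
    have h0 : 𝒱.Y 𝒱.ω 1 𝒱.vac = 0 := by rw [𝒱.creation 𝒱.ω 1 (by omega), if_neg (by omega)]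
    simp only [hD, LinearMap.add_apply, LinearMap.sub_apply, Module.End.mul_apply, h, h0, map_zero,
      LinearMap.smul_apply]
    module
  have hzero : ∀ (β : ZMod 2) (c : V), 𝒱.HasParity β c → ∀ m, D m c = 0 := by
    intro β c hc m
    obtain ⟨N₁, h1⟩ := 𝒱.exists_localOfOrder 𝒱.hasParity_ω hα
    obtain ⟨N₂, h2⟩ := 𝒱.exists_localOfOrder hα hc
    obtain ⟨N₃, h3⟩ := 𝒱.exists_localOfOrder 𝒱.hasParity_ω hc
    rw [zero_mul, paritySign_zero] at h1 h3
    have hF := exists_shift_pow_eq_zero h1 h2 h3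
    set s := paritySign (α * β)
    set N := N₁ + N₃ + N₂
    set K : ℤ × ℤ × ℤ → Module.End ℂ V := fun x =>
      𝒱.Y a x.2.1 * 𝒱.Y c x.2.2 - s • (𝒱.Y c x.2.2 * 𝒱.Y a x.2.1) with hK
    have hK0 : (shiftDiff (Module.End ℂ V) idx₂ idx₃ ^ N) K = 0 := by
      refine pow_apply_eq_zero_of_le (a := N₂) ?_ (by omega)
      funext ⟨l, m, n⟩
      rw [shiftDiff_pow_apply, Pi.zero_apply, ← h2 m n]
      refine Finset.sum_congr rfl fun j hj => ?_
      have hj : j ≤ N₂ := Nat.lt_succ_iff.mp (Finset.mem_range.mp hj)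
      have e : m + ((N₂ - j : ℕ) : ℤ) = m + N₂ - j := by omega
      simp [hK, e]
    have hK1 : (shiftDiff (Module.End ℂ V) idx₂ idx₃ ^ (N + 1)) K = 0 := pow_apply_eq_zero_of_le hK0 (by omega)
    have hsum : (shiftDiff (Module.End ℂ V) idx₂ idx₃ ^ (N + 1)) ((fun x : ℤ × ℤ × ℤ =>
        (𝒱.Y 𝒱.ω x.1 * 𝒱.Y a x.2.1 - 𝒱.Y a x.2.1 * 𝒱.Y 𝒱.ω x.1) * 𝒱.Y c x.2.2 -
        s • (𝒱.Y c x.2.2 * (𝒱.Y 𝒱.ω x.1 * 𝒱.Y a x.2.1 - 𝒱.Y a x.2.1 * 𝒱.Y 𝒱.ω x.1))) +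
        mulIndex K + (1 - wt : ℂ) • K) = 0 := by
      rw [map_add, map_add, map_smul, hK1, shift_pow_mulIndex, hK1, hK0,
        pow_apply_eq_zero_of_le hF (show N ≤ N + 1 by omega)]
      simp
    -- At these indices, applied to the vacuum, the terms with a positive shift of the third index
    -- contain `c(i)𝟏 = 0` with `i ≥ 0`. Only `D m (c(-1)𝟏) = D m c` survives.
    have h := LinearMap.congr_fun (congrFun hsum (1, m - (N + 1 : ℕ), -1)) 𝒱.vac
    rw [shiftDiff_pow_apply, Finset.sum_range_succ', LinearMap.add_apply, Pi.zero_apply,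
      LinearMap.zero_apply] at h
    have hG : ∀ x : ℤ × ℤ × ℤ, x.1 = 1 → ((fun x : ℤ × ℤ × ℤ =>
        (𝒱.Y 𝒱.ω x.1 * 𝒱.Y a x.2.1 - 𝒱.Y a x.2.1 * 𝒱.Y 𝒱.ω x.1) * 𝒱.Y c x.2.2 -
        s • (𝒱.Y c x.2.2 * (𝒱.Y 𝒱.ω x.1 * 𝒱.Y a x.2.1 - 𝒱.Y a x.2.1 * 𝒱.Y 𝒱.ω x.1))) +
        mulIndex K + (1 - wt : ℂ) • K) x 𝒱.vac = D x.2.1 (𝒱.Y c x.2.2 𝒱.vac) := by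
      rintro ⟨l, m, n⟩ rfl
      have h5 := congrArg (fun X => s • 𝒱.Y c n X) (hvac m)
      simp only [hD, LinearMap.add_apply, LinearMap.sub_apply, Module.End.mul_apply,
        LinearMap.smul_apply, map_add, map_sub, map_smul, map_zero, smul_zero] at h5
      simp only [hD, hK, mulIndex, Pi.add_apply, Pi.smul_apply, LinearMap.coe_mk, AddHom.coe_mk,
        LinearMap.add_apply, LinearMap.sub_apply, Module.End.mul_apply, LinearMap.smul_apply,
        map_sub]
      linear_combination (norm := module) -h5
    rw [LinearMap.sum_apply, Finset.sum_eq_zero, zero_add, LinearMap.smul_apply, hG _ (by simp)] at h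
    · have hc1 := 𝒱.creation c (-1) le_rfl
      simp only [if_true] at hc1
      simpa [hc1] using h
    · intro j _
      rw [LinearMap.smul_apply, hG _ (by simp)]
      have : 𝒱.Y c (-1 + ((j + 1 : ℕ) : ℤ)) 𝒱.vac = 0 := by
        rw [𝒱.creation c _ (by omega), if_neg (by omega)]
      have e : ((1, m - (N + 1 : ℕ), -1) + (N + 1 - (j + 1)) • ((0, 1, 0) : ℤ × ℤ × ℤ) +
          (j + 1) • ((0, 0, 1) : ℤ × ℤ × ℤ)).2.2 = -1 + ((j + 1 : ℕ) : ℤ) := by simp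
      rw [e, this, map_zero, smul_zero]
  have hD0 : D n b = 0 := by
    obtain ⟨b₀, b₁, rfl, h0, h1⟩ := exists_parity_decomposition 𝒱.σ_σ b
    rw [map_add, hzero 0 b₀ h0, hzero 1 b₁ h1, add_zero]
  rw [mem_weightSpace] at hb ⊢
  simp only [hD, LinearMap.add_apply, LinearMap.sub_apply, Module.End.mul_apply, hb,
    LinearMap.smul_apply, map_smul] at hD0
  push_cast
  linear_combination (norm := module) hD0

end VOSA

/-! ### Projections of an internal direct sum -/

section GradeProj

variable {E ι : Type*} [AddCommGroup E] [Module ℂ E] [DecidableEq ι] {A : ι → Submodule ℂ E}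
  (h : DirectSum.IsInternal A)

lemma gradeProj_of_mem {i : ι} {x : E} (hx : x ∈ A i) : (gradeProj h i x : E) = x := by
  have : (LinearEquiv.ofBijective (DirectSum.coeLinearMap A) h).symm x =
      DirectSum.lof ℂ ι (fun i => A i) i ⟨x, hx⟩ := by
    rw [LinearEquiv.symm_apply_eq]
    exact (DirectSum.coeLinearMap_lof A i ⟨x, hx⟩).symm
  simp [gradeProj, this, DirectSum.component.lof_self]

lemma gradeProj_of_mem_ne {i j : ι} (hij : i ≠ j) {x : E} (hx : x ∈ A j) : gradeProj h i x = 0 := by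
  have : (LinearEquiv.ofBijective (DirectSum.coeLinearMap A) h).symm x =
      DirectSum.lof ℂ ι (fun i => A i) j ⟨x, hx⟩ := by
    rw [LinearEquiv.symm_apply_eq]
    exact (DirectSum.coeLinearMap_lof A j ⟨x, hx⟩).symm
  simp only [gradeProj, LinearMap.comp_apply, LinearEquiv.coe_coe, this]
  rw [DirectSum.component.of, dif_neg hij.symm]

lemma finite_gradeProj_ne_zero (x : E) : {i | gradeProj h i x ≠ 0}.Finite := by
  refine (DFinsupp.finite_support
    ((LinearEquiv.ofBijective (DirectSum.coeLinearMap A) h).symm x)).subset fun i hi => ?_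
  exact hi

include h in
lemma internal_induction {P : E → Prop} (h0 : P 0) (hadd : ∀ x y, P x → P y → P (x + y))
    (hom : ∀ i, ∀ x ∈ A i, P x) (x : E) : P x :=
  Submodule.iSup_induction A (motive := P) (h.submodule_iSup_eq_top ▸ Submodule.mem_top) hom h0 hadd

lemma gradeProj_commute {T : Module.End ℂ E} (hT : ∀ i, ∀ x ∈ A i, T x ∈ A i) (i : ι) (x : E) :
    (gradeProj h i (T x) : E) = T (gradeProj h i x) := by
  refine internal_induction h (P := fun x => (gradeProj h i (T x) : E) = T (gradeProj h i x))
    (by simp) (fun x y hx hy => by simp only [map_add, Submodule.coe_add, hx, hy]) ?_ x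
  intro j x hx
  by_cases hij : i = j
  · subst hij
    rw [gradeProj_of_mem h hx, gradeProj_of_mem h (hT _ _ hx)]
  · rw [gradeProj_of_mem_ne h hij hx, gradeProj_of_mem_ne h hij (hT _ _ hx)]; simp

lemma eq_sum_gradeProj (x : E) :
    x = ∑ i ∈ (finite_gradeProj_ne_zero h x).toFinset, (gradeProj h i x : E) := by
  have key : ∀ S : Finset ι, (finite_gradeProj_ne_zero h x).toFinset ⊆ S →
      ∑ i ∈ S, (gradeProj h i x : E) =
        ∑ i ∈ (finite_gradeProj_ne_zero h x).toFinset, (gradeProj h i x : E) := by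
    intro S hS
    refine (Finset.sum_subset hS fun i _ hi => ?_).symm
    simp only [Set.Finite.mem_toFinset, Set.mem_ofPred_eq, not_not] at hi
    simp [hi]
  have : ∃ S₀ : Finset ι, ∀ S, S₀ ⊆ S → x = ∑ i ∈ S, (gradeProj h i x : E) := by
    refine internal_induction h
      (P := fun x => ∃ S₀ : Finset ι, ∀ S, S₀ ⊆ S → x = ∑ i ∈ S, (gradeProj h i x : E))
      ⟨∅, by simp⟩ ?_ ?_ x
    · rintro x y ⟨S, hS⟩ ⟨T, hT⟩
      refine ⟨S ∪ T, fun U hU => ?_⟩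
      simp only [map_add, Submodule.coe_add, Finset.sum_add_distrib]
      rw [← hS U (Finset.union_subset_left hU), ← hT U (Finset.union_subset_right hU)]
    · intro j x hx
      refine ⟨{j}, fun S hS => ?_⟩
      rw [Finset.sum_eq_single_of_mem j (hS (Finset.mem_singleton_self j)) fun i _ hi => by
        rw [gradeProj_of_mem_ne h hi hx]; rfl, gradeProj_of_mem h hx]
  obtain ⟨S₀, hS₀⟩ := this
  exact (hS₀ _ Finset.subset_union_left).trans (key _ Finset.subset_union_right)

end GradeProj

/-! ### Parity of components and square bracket modes -/

namespace VOSA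

variable {V : Type*} [AddCommGroup V] [Module ℂ V] (𝒱 : VOSA V)

lemma σ_mode {α : ZMod 2} {a : V} (ha : 𝒱.HasParity α a) (n : ℤ) (b : V) :
    𝒱.σ (𝒱.Y a n b) = paritySign α • 𝒱.Y a n (𝒱.σ b) := by
  obtain ⟨b₀, b₁, rfl, h0, h1⟩ := exists_parity_decomposition 𝒱.σ_σ b
  simp only [map_add, h0, h1, 𝒱.parity _ _ _ _ n ha h0, 𝒱.parity _ _ _ _ n ha h1, map_smul,
    paritySign_add, mul_smul, smul_add]

lemma σ_mem_weightSpace {r : ℝ} {a : V} (ha : a ∈ 𝒱.weightSpace r) : 𝒱.σ a ∈ 𝒱.weightSpace r := by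
  rw [mem_weightSpace] at ha ⊢
  have := 𝒱.σ_mode 𝒱.hasParity_ω 1 a
  rwa [paritySign_zero, one_smul, ha, map_smul, eq_comm] at this

lemma weightProj_mem (r : ℝ) (a : V) : 𝒱.weightProj r a ∈ 𝒱.weightSpace r :=
  (gradeProj 𝒱.internal r a).2

lemma hasParity_weightProj {α : ZMod 2} {a : V} (ha : 𝒱.HasParity α a) (r : ℝ) :
    𝒱.HasParity α (𝒱.weightProj r a) := by
  have := gradeProj_commute 𝒱.internal (T := 𝒱.σ) (fun i x hx => 𝒱.σ_mem_weightSpace hx) r a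
  rw [HasParity, weightProj, ← this, ha, map_smul]; rfl

/-- The weight components of a vector of definite parity have that parity, since `σ` commutes with
`L(0)`. -/
lemma homogeneous_induction {α : ZMod 2} {P : V → Prop} (h0 : P 0)
    (hadd : ∀ x y, P x → P y → P (x + y))
    (hom : ∀ (r : ℝ), ∀ x ∈ 𝒱.weightSpace r, 𝒱.HasParity α x → P x) {x : V}
    (hx : 𝒱.HasParity α x) : P x := by
  rw [eq_sum_gradeProj 𝒱.internal x]
  exact Finset.sum_induction _ P hadd h0 fun r _ =>
    hom r _ (𝒱.weightProj_mem r x) (𝒱.hasParity_weightProj hx r)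

lemma exists_truncation (a b : V) : ∃ N : ℕ, ∀ i : ℕ, N ≤ i → 𝒱.Y a i b = 0 := by
  obtain ⟨N, hN⟩ := 𝒱.truncation a b
  exact ⟨N.toNat, fun i hi => hN i (by omega)⟩

lemma mode_neg_two_vac (a : V) : 𝒱.Y a (-2) 𝒱.vac = 𝒱.Y 𝒱.ω 0 a := by
  have h1 := 𝒱.translation a (-1)
  have h2 := 𝒱.creation (𝒱.Y 𝒱.ω 0 a) (-1) le_rfl
  rw [if_pos rfl, h1] at h2
  simpa using h2

lemma smeval_descPochhammer_eq_eval (x : ℂ) (i : ℕ) :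
    (descPochhammer ℤ i).smeval x = (descPochhammer ℂ i).eval x := by
  induction i with
  | zero => simp
  | succ i ih =>
    simp [descPochhammer_succ_right, Polynomial.smeval_mul, Polynomial.smeval_sub, ih,
      Polynomial.smeval_natCast]

lemma natDegree_sqCoeff_poly (w : ℝ) (i : ℕ) :
    ((((i.factorial : ℂ)⁻¹) • (descPochhammer ℂ i).comp
      (Polynomial.X + Polynomial.C ((w : ℂ) - 1)))).natDegree ≤ i := by
  refine (Polynomial.natDegree_smul_le _ _).trans ?_
  rw [Polynomial.natDegree_comp, descPochhammer_natDegree, Polynomial.natDegree_X_add_C, mul_one]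

lemma sqCoeff_eq_zero (w : ℝ) {i m : ℕ} (h : i < m) : sqCoeff w i m = 0 :=
  Polynomial.coeff_eq_zero_of_natDegree_lt ((natDegree_sqCoeff_poly w i).trans_lt h)

lemma sum_sqCoeff (w : ℝ) {i K : ℕ} (h : i < K) (x : ℂ) :
    ∑ m ∈ Finset.range K, sqCoeff w i m * x ^ m = Ring.choose ((w : ℂ) - 1 + x) i := by
  unfold sqCoeff
  rw [← Polynomial.eval_eq_sum_range' ((natDegree_sqCoeff_poly w i).trans_lt h),
    Polynomial.eval_smul, Polynomial.eval_comp, Ring.choose_eq_smul]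
  congr 1
  rw [smeval_descPochhammer_eq_eval, Polynomial.eval_add, Polynomial.eval_X, Polynomial.eval_C,
    add_comm]

lemma sqMode_eq_sum (w : ℝ) (a u : V) {N : ℕ} (hN : ∀ i : ℕ, N ≤ i → 𝒱.Y a i u = 0) (m : ℕ) :
    𝒱.sqMode w a m u =
      ∑ i ∈ Finset.range N, ((m.factorial : ℂ) * sqCoeff w i m) • 𝒱.Y a (i : ℤ) u := by
  refine finsum_eq_sum_of_support_subset _ fun i hi => ?_
  by_contra h
  simp only [Finset.coe_range, Set.mem_Iio, not_lt] at h
  exact hi (by simp only [hN i h, smul_zero])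

lemma sqMode_eq_zero (w : ℝ) (a u : V) {N : ℕ} (hN : ∀ i : ℕ, N ≤ i → 𝒱.Y a i u = 0) {m : ℕ}
    (hm : N ≤ m) : 𝒱.sqMode w a m u = 0 := by
  rw [𝒱.sqMode_eq_sum w a u hN]
  refine Finset.sum_eq_zero fun i hi => ?_
  rw [sqCoeff_eq_zero w ((Finset.mem_range.mp hi).trans_le hm), mul_zero, zero_smul]

end VOSA

lemma neg_one_pow_mul_choose_neg_two (i : ℕ) :
    (-1 : ℂ) ^ i * Ring.choose ((-2 : ℤ) : ℂ) i = i + 1 := by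
  have h1 : ∀ i : ℕ, (-1 : ℂ) ^ i * Ring.choose (-1 : ℂ) i = 1 := by
    intro i
    induction i with
    | zero => simp
    | succ i ih =>
      have := Ring.choose_succ_succ (-1 : ℂ) i
      rw [neg_add_cancel, Ring.choose_zero_succ] at this
      rw [pow_succ]
      linear_combination ih + (-1) ^ i * this
  push_cast
  induction i with
  | zero => simp
  | succ i ih =>
    have := Ring.choose_succ_succ (-2 : ℂ) i
    rw [show (-2 : ℂ) + 1 = -1 by norm_num] at this
    have h2 := h1 (i + 1)
    rw [pow_succ] at h2 ⊢
    push_cast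
    linear_combination ih + h2 + (-1) ^ i * this

/-! ### Commutators on the module -/

namespace VOSAModule

variable {V : Type*} [AddCommGroup V] [Module ℂ V] {𝒱 : VOSA V}
  {M : Type*} [AddCommGroup M] [Module ℂ M] (ℳ : VOSAModule 𝒱 M)

lemma σ_mode {α : ZMod 2} {a : V} (ha : 𝒱.HasParity α a) (n : ℤ) (w : M) :
    ℳ.σ (ℳ.Y a n w) = paritySign α • ℳ.Y a n (ℳ.σ w) := by
  obtain ⟨b₀, b₁, rfl, h0, h1⟩ := exists_parity_decomposition ℳ.σ_σ w
  simp only [map_add, h0, h1, ℳ.parity _ _ _ _ n ha h0, ℳ.parity _ _ _ _ n ha h1, map_smul,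
    paritySign_add, mul_smul, smul_add]

/-- The Jacobi identity at `n = 0`, where `binom(0, i)` leaves only `i = 0` on the right. -/
lemma commutator {α β : ZMod 2} {a b : V} (ha : 𝒱.HasParity α a) (hb : 𝒱.HasParity β b)
    {N : ℕ} (hN : ∀ i : ℕ, N ≤ i → 𝒱.Y a i b = 0) (m k : ℤ) :
    ℳ.Y a m * ℳ.Y b k - paritySign (α * β) • (ℳ.Y b k * ℳ.Y a m) =
      ∑ i ∈ Finset.range N, Ring.choose (m : ℂ) i • ℳ.Y (𝒱.Y a i b) (m + k - i) := by
  ext w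
  have h := ℳ.jacobi α β a b w m 0 k ha hb
  rw [finsum_eq_sum_of_support_subset (s := Finset.range N) _ (fun i hi => by
      by_contra h
      simp only [Finset.coe_range, Set.mem_Iio, not_lt] at h
      exact hi (by simp only [zero_add, hN i h, map_zero, Pi.zero_apply, LinearMap.zero_apply,
        smul_zero])),
    finsum_eq_single _ 0 (fun i hi => by
      obtain ⟨j, rfl⟩ := Nat.exists_eq_succ_of_ne_zero hi
      simp [Ring.choose_zero_succ])] at h
  simp only [LinearMap.sub_apply, Module.End.mul_apply, LinearMap.smul_apply, LinearMap.sum_apply]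
  simpa using h.symm

/-- Since `L(-1)a = a(-2)𝟏`, this is the Jacobi identity for `a` and `𝟏` at `m = 0`, `n = -2`. The
only nonzero mode of the vacuum is `-1`, so at most one index contributes on the right. -/
lemma translation (a : V) (k : ℤ) {α : ZMod 2} (ha : 𝒱.HasParity α a) :
    ℳ.Y (𝒱.Y 𝒱.ω 0 a) k = (-(k : ℂ)) • ℳ.Y a (k - 1) := by
  ext w
  have hvac : 𝒱.HasParity 0 𝒱.vac := by
    rw [VOSA.HasParity, paritySign_zero, one_smul, 𝒱.σ_vac]
  have h := ℳ.jacobi α 0 a 𝒱.vac w 0 (-2) k ha hvac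
  rw [finsum_eq_single _ 0 (fun i hi => by
      obtain ⟨j, rfl⟩ := Nat.exists_eq_succ_of_ne_zero hi
      simp [Ring.choose_zero_succ])] at h
  simp only [Nat.cast_zero, add_zero, 𝒱.mode_neg_two_vac, Ring.choose_zero_right, one_smul,
    zero_add, sub_zero, ℳ.vacuum, neg_one_pow_mul_choose_neg_two, mul_zero, paritySign_zero,
    mul_one] at h
  rw [h]
  rcases lt_or_ge k 0 with hk | hk
  · rw [finsum_eq_single _ (-1 - k).toNat (fun i hi => by
      rw [if_neg (by omega), if_neg (by omega)]; simp)]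
    rw [if_pos (by omega), if_neg (by omega)]
    have e : (((-1 - k).toNat : ℕ) : ℤ) = -1 - k := by omega
    have e' : (((-1 - k).toNat : ℕ) : ℂ) = -1 - k := by exact_mod_cast congrArg (Int.cast : ℤ → ℂ) e
    rw [e, e', show -2 - (-1 - k) = k - 1 by ring,
      show (-1 - k + 1 : ℂ) = -k by ring]
    simp
  -- At `k = 0` no index contributes, which matches the factor `-k`.
  · rcases hk.eq_or_lt with rfl | hk
    · rw [finsum_eq_zero_of_forall_eq_zero (fun i => by
        rw [if_neg (by omega), if_neg (by omega)]; simp)]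
      simp
    · rw [finsum_eq_single _ (k - 1).toNat (fun i hi => by
        rw [if_neg (by omega), if_neg (by omega)]; simp)]
      rw [if_neg (by omega), if_pos (by omega)]
      have e : (((k - 1).toNat : ℕ) : ℤ) = k - 1 := by omega
      have e' : (((k - 1).toNat : ℕ) : ℂ) = k - 1 := by
        exact_mod_cast congrArg (Int.cast : ℤ → ℂ) e
      rw [e, e']
      norm_num

/-- `M_h`. -/
abbrev eigen (h : ℂ) : Submodule ℂ M := (ℳ.Y 𝒱.ω 1).eigenspace h

lemma mem_eigen {h : ℂ} {w : M} : w ∈ ℳ.eigen h ↔ ℳ.Y 𝒱.ω 1 w = h • w :=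
  Module.End.mem_eigenspace_iff

/-- In the commutator formula for `ω(1)` only `i = 0, 1` remain: `L(-1)a`, which contributes `-(k +
1)` by translation, and `L(0)a`. -/
lemma commutator_L₀ {α : ZMod 2} {a : V} {wt : ℝ} (ha : 𝒱.HasParity α a)
    (hwt : a ∈ 𝒱.weightSpace wt) (k : ℤ) :
    ℳ.Y 𝒱.ω 1 * ℳ.Y a k - ℳ.Y a k * ℳ.Y 𝒱.ω 1 = ((wt : ℂ) - k - 1) • ℳ.Y a k := by
  obtain ⟨N, hN⟩ := 𝒱.exists_truncation 𝒱.ω a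
  have h := ℳ.commutator 𝒱.hasParity_ω ha (N := N + 2) (fun i hi => hN i (by omega)) 1 k
  rw [zero_mul, paritySign_zero, one_smul, ← Finset.sum_subset (s₁ := Finset.range 2)
    (by simp) (fun i _ hi => by
      rw [Finset.mem_range, not_lt] at hi
      rw [show ((1 : ℤ) : ℂ) = ((1 : ℕ) : ℂ) by simp, Ring.choose_natCast,
        Nat.choose_eq_zero_of_lt (by omega)]
      simp)] at h
  rw [h, Finset.sum_range_succ, Finset.sum_range_one]
  simp only [Nat.cast_zero, Nat.cast_one, Ring.choose_zero_right, one_smul, Ring.choose_one_right,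
    (𝒱.mem_weightSpace).mp hwt, ℳ.translation a _ ha, map_smul, Pi.smul_apply, Int.cast_one,
    sub_zero, add_sub_cancel_left]
  push_cast
  module

lemma mode_mem_eigen {α : ZMod 2} {a : V} {wt : ℝ} (ha : 𝒱.HasParity α a)
    (hwt : a ∈ 𝒱.weightSpace wt) (k : ℤ) {h : ℂ} {w : M} (hw : w ∈ ℳ.eigen h) :
    ℳ.Y a k w ∈ ℳ.eigen (h + (wt - k - 1)) := by
  rw [mem_eigen] at hw ⊢
  have := LinearMap.congr_fun (ℳ.commutator_L₀ ha hwt k) w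
  simp only [LinearMap.sub_apply, Module.End.mul_apply, hw, map_smul, LinearMap.smul_apply] at this
  rw [add_smul, ← this]; abel

lemma finite_degMode_support (a : V) (d : ℝ) :
    (Function.support fun k : ℤ => ℳ.Y (𝒱.weightProj (d + k + 1) a) k).Finite := by
  refine ((finite_gradeProj_ne_zero 𝒱.internal a).preimage
    (f := fun k : ℤ => d + k + 1) (fun x _ y _ hxy => by simpa using hxy)).subset fun k hk => ?_
  intro h
  exact hk (by simp [VOSA.weightProj, h])

/-- `degMode` as a linear map. -/
def degModeₗ (d : ℝ) : V →ₗ[ℂ] Module.End ℂ M where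
  toFun a := ℳ.degMode a d
  map_add' a b := by
    unfold degMode
    rw [← finsum_add_distrib (ℳ.finite_degMode_support a d) (ℳ.finite_degMode_support b d)]
    simp [VOSA.weightProj]
  map_smul' c a := by
    unfold degMode
    rw [RingHom.id_apply, smul_finsum' c (ℳ.finite_degMode_support a d)]
    simp [VOSA.weightProj]

lemma degModeₗ_apply (d : ℝ) (a : V) : ℳ.degModeₗ d a = ℳ.degMode a d := rfl

lemma degMode_of_mem {a : V} {wt d : ℝ} (ha : a ∈ 𝒱.weightSpace wt) {k : ℤ} (hk : wt = d + k + 1) :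
    ℳ.degMode a d = ℳ.Y a k := by
  subst hk
  unfold degMode
  rw [finsum_eq_single _ k]
  · rw [VOSA.weightProj, gradeProj_of_mem 𝒱.internal ha]
  · intro i hi
    rw [VOSA.weightProj, gradeProj_of_mem_ne 𝒱.internal (by simpa using hi) ha]
    simp

lemma degMode_of_mem_ne {a : V} {wt d : ℝ} (ha : a ∈ 𝒱.weightSpace wt)
    (hk : ∀ k : ℤ, wt ≠ d + k + 1) : ℳ.degMode a d = 0 := by
  unfold degMode
  refine finsum_eq_zero_of_forall_eq_zero fun i => ?_
  rw [VOSA.weightProj, gradeProj_of_mem_ne 𝒱.internal (hk i).symm ha]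
  simp

lemma σ_degMode {α : ZMod 2} {a : V} (ha : 𝒱.HasParity α a) (d : ℝ) :
    ℳ.σ * ℳ.degMode a d = paritySign α • (ℳ.degMode a d * ℳ.σ) := by
  refine 𝒱.homogeneous_induction
    (P := fun a => ℳ.σ * ℳ.degMode a d = paritySign α • (ℳ.degMode a d * ℳ.σ)) ?_ ?_ ?_ ha
  · simp [← degModeₗ_apply]
  · intro x y hx hy
    simp only [← degModeₗ_apply, map_add, mul_add, add_mul, smul_add] at hx hy ⊢
    rw [hx, hy]
  · intro r x hx hxα
    by_cases h : ∃ k : ℤ, r = d + k + 1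
    · obtain ⟨k, hk⟩ := h
      rw [ℳ.degMode_of_mem hx hk]
      ext w
      exact ℳ.σ_mode hxα k w
    · push Not at h
      rw [ℳ.degMode_of_mem_ne hx h]; simp

/-- The vector `u` need not be homogeneous and each weight component has its own truncation bound.
Stating the formula for all large `N` makes it additive in `u`. -/
lemma degMode_commutator {v u : V} {wt d₀ : ℝ} (hv : v ∈ 𝒱.weightSpace wt) {pv pu : ZMod 2}
    (hpv : 𝒱.HasParity pv v) (hpu : 𝒱.HasParity pu u) {k : ℤ} (hk : wt = d₀ + k + 1) (d : ℝ) :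
    ∀ᶠ N in Filter.atTop, ℳ.degMode v d₀ * ℳ.degMode u d -
      paritySign (pv * pu) • (ℳ.degMode u d * ℳ.degMode v d₀) =
      ∑ i ∈ Finset.range N, Ring.choose (k : ℂ) i • ℳ.degMode (𝒱.Y v i u) (d + d₀) := by
  rw [ℳ.degMode_of_mem hv hk]
  refine 𝒱.homogeneous_induction (P := fun u => ∀ᶠ N in Filter.atTop, ℳ.Y v k * ℳ.degMode u d -
      paritySign (pv * pu) • (ℳ.degMode u d * ℳ.Y v k) =
      ∑ i ∈ Finset.range N, Ring.choose (k : ℂ) i • ℳ.degMode (𝒱.Y v i u) (d + d₀)) ?_ ?_ ?_ hpu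
  · simp [← degModeₗ_apply]
  · intro x y hx hy
    filter_upwards [hx, hy] with N hx hy
    simp only [← degModeₗ_apply, map_add, mul_add, add_mul, smul_add,
      Finset.sum_add_distrib] at hx hy ⊢
    rw [← hx, ← hy]; abel
  · intro r x hx hxα
    obtain ⟨N, hN⟩ := 𝒱.exists_truncation v x
    filter_upwards [Filter.eventually_ge_atTop N] with N' hN'
    have hmem : ∀ i : ℕ, 𝒱.Y v i x ∈ 𝒱.weightSpace (wt + r - i - 1) := fun i => by
      simpa using 𝒱.mode_mem_weightSpace hv hpv hx i
    by_cases h : ∃ k' : ℤ, r = d + k' + 1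
    · obtain ⟨k', hk'⟩ := h
      rw [ℳ.degMode_of_mem hx hk', ℳ.commutator hpv hxα (fun i hi => hN i (hN'.trans hi))]
      refine Finset.sum_congr rfl fun i _ => ?_
      rw [ℳ.degMode_of_mem (hmem i) (k := k + k' - i) (by push_cast; rw [hk, hk']; ring)]
    · push Not at h
      rw [ℳ.degMode_of_mem_ne hx h, Finset.sum_eq_zero]
      · simp
      · intro i _
        rw [ℳ.degMode_of_mem_ne (hmem i), smul_zero]
        intro j hj
        refine h (j - k + i) ?_
        push_cast
        linarith

/-- Since `k = wt - 1 - d₀`, the binomial `binom(k, i)` is the generating polynomial of `sqCoeff wt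
i` at `-d₀`. Exchanging the sums over `i` and `m` assembles the square bracket modes. -/
lemma degMode_commutator_sqMode {v u : V} {wt d₀ : ℝ} (hv : v ∈ 𝒱.weightSpace wt) {pv pu : ZMod 2}
    (hpv : 𝒱.HasParity pv v) (hpu : 𝒱.HasParity pu u) {k : ℤ} (hk : wt = d₀ + k + 1) (d : ℝ) :
    ∀ᶠ K in Filter.atTop, ℳ.degMode v d₀ * ℳ.degMode u d -
      paritySign (pv * pu) • (ℳ.degMode u d * ℳ.degMode v d₀) =
      ∑ m ∈ Finset.range K, ((-d₀ : ℂ) ^ m / (m.factorial : ℂ)) •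
        ℳ.degMode (𝒱.sqMode wt v m u) (d + d₀) := by
  obtain ⟨N₀, hN₀⟩ := 𝒱.exists_truncation v u
  obtain ⟨N, hN, hNN⟩ := ((ℳ.degMode_commutator hv hpv hpu hk d).and
    (Filter.eventually_ge_atTop N₀)).exists
  filter_upwards [Filter.eventually_ge_atTop N] with K hK
  rw [hN]
  simp only [𝒱.sqMode_eq_sum wt v u (N := N) (fun i hi => hN₀ i (hNN.trans hi)),
    ← degModeₗ_apply, map_sum, map_smul, Finset.smul_sum, smul_smul]
  rw [Finset.sum_comm]
  refine Finset.sum_congr rfl fun i hi => ?_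
  rw [← Finset.sum_smul]
  congr 1
  have : (k : ℂ) = (wt : ℂ) - 1 + (-d₀ : ℂ) := by rw [hk]; push_cast; ring
  rw [this, ← VOSA.sum_sqCoeff wt ((Finset.mem_range.mp hi).trans_le hK)]
  refine Finset.sum_congr rfl fun m _ => ?_
  have : (m.factorial : ℂ) ≠ 0 := by exact_mod_cast m.factorial_ne_zero
  field_simp

end VOSAModule

/-! ### Passing an operator through a product, and the recursion in the weight -/

lemma paritySign_mul_sum {ι : Type*} (α : ZMod 2) (p : ι → ZMod 2) (S : Finset ι) :
    paritySign (α * ∑ i ∈ S, p i) = ∏ i ∈ S, paritySign (α * p i) := by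
  classical
  induction S using Finset.induction_on with
  | empty => simp [paritySign_zero]
  | insert i S hi ih =>
    rw [Finset.sum_insert hi, Finset.prod_insert hi, mul_add, paritySign_add, ih]

lemma mul_prod_ofFn {R : Type*} [Ring R] [Algebra ℂ R] (a : R) {n : ℕ} (B C : Fin n → R)
    (s : Fin n → ℂ) (h : ∀ i, a * B i - s i • (B i * a) = C i) :
    a * (List.ofFn B).prod =
      ∑ r, (∏ i with i < r, s i) • (List.ofFn (Function.update B r (C r))).prod +
      (∏ i, s i) • ((List.ofFn B).prod * a) := by
  induction n with
  | zero => simp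
  | succ n ih =>
    have ih := ih (fun i => B i.succ) (fun i => C i.succ) (fun i => s i.succ) (fun i => h i.succ)
    have h0 : a * B 0 = C 0 + s 0 • (B 0 * a) := by rw [← h 0]; abel
    have hu : ∀ r : Fin n, (fun i : Fin n => Function.update B r.succ (C r.succ) i.succ) =
        Function.update (fun i : Fin n => B i.succ) r (C r.succ) := fun r => by
      funext i
      by_cases hi : i = r
      · subst hi; simp
      · rw [Function.update_of_ne hi, Function.update_of_ne (by simpa using hi)]
    rw [List.ofFn_succ, List.prod_cons, ← mul_assoc, h0, add_mul, smul_mul_assoc, mul_assoc, ih,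
      Fin.sum_univ_succ, Fin.prod_univ_succ]
    simp only [List.ofFn_succ, List.prod_cons, hu, Function.update_self, Finset.prod_filter,
      Fin.prod_univ_succ, Fin.succ_lt_succ_iff, Fin.succ_pos, if_true, Fin.not_lt_zero, if_false,
      Finset.prod_const_one, one_smul]
    have hu0 : (fun i : Fin n => Function.update B 0 (C 0) i.succ) = fun i => B i.succ := by
      funext i; rw [Function.update_of_ne (Fin.succ_ne_zero i)]
    have hu1 : ∀ r : Fin n, Function.update B r.succ (C r.succ) 0 = B 0 := fun r =>
      Function.update_of_ne (Fin.succ_ne_zero r).symm _ _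
    simp only [hu0, hu1, mul_add, smul_add, Finset.mul_sum, Finset.smul_sum, mul_smul_comm,
      smul_smul, mul_assoc, add_assoc]

/-- Solution of the recursion `T(h) = R(h) + θ T(h + d)` for functions that vanish far below. -/
lemma solve_recursion {T R : ℂ → ℂ} {θ : ℂ} {d : ℝ} (hθ : θ ≠ 0)
    (hrec : ∀ h, T h = R h + θ * T (h + d)) (h : ℂ) {J : ℕ} (hJ : 1 ≤ J)
    (hT : d ≠ 0 → ∀ j : ℕ, J ≤ j + 1 → T (h - |d| * j) = 0) :
    T h = (if θ = 1 ∧ d = 0 then T h else 0) -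
      ∑ j ∈ Finset.range J, outerCoeff θ d j * R (h - |d| * j) := by
  rcases lt_trichotomy d 0 with hd | rfl | hd
  · have key : ∀ J : ℕ, T h = ∑ j ∈ Finset.range J, θ ^ j * R (h - |d| * j) +
        θ ^ J * T (h - |d| * J) := by
      intro J
      induction J with
      | zero => simp
      | succ J ih =>
        conv_lhs => rw [ih, hrec (h - |d| * J)]
        rw [Finset.sum_range_succ, abs_of_neg hd]
        have : h - ((-d : ℝ) : ℂ) * J + d = h - ((-d : ℝ) : ℂ) * ((J + 1 : ℕ) : ℂ) := by
          push_cast; ring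
        rw [this]; ring
    rw [if_neg (by rintro ⟨-, h⟩; exact hd.ne h), zero_sub, ← Finset.sum_neg_distrib]
    conv_lhs => rw [key J, hT hd.ne J (by omega), mul_zero, add_zero]
    refine Finset.sum_congr rfl fun j _ => ?_
    rw [outerCoeff, if_pos hd]; ring
  · obtain ⟨J, rfl⟩ : ∃ J', J = J' + 1 := ⟨J - 1, by omega⟩
    have h1 := hrec h
    rw [Complex.ofReal_zero, add_zero] at h1
    rw [Finset.sum_range_succ', Finset.sum_eq_zero (fun j _ => by simp [outerCoeff])]
    -- For `d = 0` the recursion reads `(1 - θ) T h = R h`. If `θ = 1` it says nothing about `T h`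
    -- and forces `R h = 0`, so the value `-1` of `outerCoeff` is immaterial.
    by_cases h2 : θ = 1
    · subst h2
      have : R h = 0 := by linear_combination -h1
      simp [this]
    · have h3 : 1 - θ ≠ 0 := sub_ne_zero.mpr (Ne.symm h2)
      simp [outerCoeff, h2]
      rw [eq_inv_mul_iff_mul_eq₀ h3]
      linear_combination h1
  · obtain ⟨J, rfl⟩ : ∃ J', J = J' + 1 := ⟨J - 1, by omega⟩
    -- For `d > 0` the recursion climbs in weight, so it is solved backwards in order to descend to
    -- where `T` vanishes.
    have hback : ∀ h, T h = θ⁻¹ * (T (h - d) - R (h - d)) := by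
      intro h
      rw [eq_inv_mul_iff_mul_eq₀ hθ, hrec (h - d)]; ring_nf
    have key : ∀ J : ℕ, T h = (θ⁻¹) ^ J * T (h - |d| * J) -
        ∑ j ∈ Finset.range J, (θ⁻¹) ^ (j + 1) * R (h - |d| * (j + 1 : ℕ)) := by
      intro J
      induction J with
      | zero => simp
      | succ J ih =>
        conv_lhs => rw [ih, hback (h - |d| * J)]
        rw [Finset.sum_range_succ, abs_of_pos hd]
        have : h - (d : ℂ) * J - d = h - (d : ℂ) * ((J + 1 : ℕ) : ℂ) := by
          push_cast; ring
        rw [this]; ring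
    -- Here `j = 0` has coefficient zero, so a range of the original length `J` allows only `J - 1`
    -- steps down. This is why vanishing is assumed already from `j + 1 = J` on.
    rw [if_neg (by rintro ⟨-, h⟩; exact hd.ne' h), zero_sub, Finset.sum_range_succ']
    conv_lhs => rw [key J, hT hd.ne' J le_rfl, mul_zero, zero_sub]
    congr 1
    rw [outerCoeff, if_neg hd.not_gt, if_pos hd, if_pos rfl, zero_mul, add_zero]
    refine Finset.sum_congr rfl fun j _ => ?_
    rw [outerCoeff, if_neg hd.not_gt, if_pos hd, if_neg (Nat.succ_ne_zero j)]

/-! ### Supertraces on weight spaces and the trace recursion -/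

namespace VOSAModule

variable {V : Type*} [AddCommGroup V] [Module ℂ V] {𝒱 : VOSA V}
  {M : Type*} [AddCommGroup M] [Module ℂ M] (ℳ : VOSAModule 𝒱 M)

/-- The trace of the compression of an operator to `M_h`. -/
def trAt (h : ℂ) : Module.End ℂ M →ₗ[ℂ] ℂ where
  toFun X := LinearMap.trace ℂ (ℳ.eigen h) (gradeProj ℳ.internal h ∘ₗ X ∘ₗ (ℳ.eigen h).subtype)
  map_add' X Y := by rw [LinearMap.add_comp, LinearMap.comp_add, map_add]
  map_smul' c X := by rw [LinearMap.smul_comp, LinearMap.comp_smul, map_smul]; rfl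

lemma strAt_eq (X : Module.End ℂ M) (h : ℂ) : ℳ.strAt X h = ℳ.trAt h (ℳ.σ * X) := rfl

/-- `strAt` as a linear map. -/
def strAtₗ (h : ℂ) : Module.End ℂ M →ₗ[ℂ] ℂ := ℳ.trAt h ∘ₗ LinearMap.mulLeft ℂ ℳ.σ

lemma strAtₗ_apply (X : Module.End ℂ M) (h : ℂ) : ℳ.strAtₗ h X = ℳ.strAt X h := rfl

lemma strAt_eq_zero {h : ℂ} (hh : ℳ.eigen h = ⊥) (X : Module.End ℂ M) : ℳ.strAt X h = 0 := by
  have : Subsingleton (ℳ.eigen h) := Submodule.subsingleton_iff_eq_bot.mpr hh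
  rw [strAt, Subsingleton.elim (gradeProj ℳ.internal h ∘ₗ ℳ.σ ∘ₗ X ∘ₗ (ℳ.eigen h).subtype) 0,
    map_zero]

/-- The operator `a` commutes with the projections up to the shift by `δ`. Both compressions are
then the two composites of a pair of maps between the finite-dimensional spaces `M_h` and `M_{h+δ}`.
No homogeneity of `X` is needed. -/
lemma trAt_mul_comm {a : Module.End ℂ M} {δ : ℂ} (ha : ∀ h, ∀ w ∈ ℳ.eigen h, a w ∈ ℳ.eigen (h + δ))
    (X : Module.End ℂ M) (h : ℂ) : ℳ.trAt h (X * a) = ℳ.trAt (h + δ) (a * X) := by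
  have := ℳ.finite h
  have := ℳ.finite (h + δ)
  let a' : ℳ.eigen h →ₗ[ℂ] ℳ.eigen (h + δ) := a.restrict (ha h)
  let X' : ℳ.eigen (h + δ) →ₗ[ℂ] ℳ.eigen h :=
    gradeProj ℳ.internal h ∘ₗ X ∘ₗ (ℳ.eigen (h + δ)).subtype
  have key : ∀ y : M, gradeProj ℳ.internal (h + δ) (a y) = a' (gradeProj ℳ.internal h y) := by
    intro y
    refine internal_induction ℳ.internal
      (P := fun y => gradeProj ℳ.internal (h + δ) (a y) = a' (gradeProj ℳ.internal h y))
      (by simp) (fun x y hx hy => by simp only [map_add, hx, hy]) ?_ y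
    intro k x hx
    by_cases hk : h = k
    · subst hk
      apply Subtype.ext
      rw [gradeProj_of_mem ℳ.internal (ha _ _ hx)]
      change a x = a (gradeProj ℳ.internal h x : M)
      rw [gradeProj_of_mem ℳ.internal hx]
    · rw [gradeProj_of_mem_ne ℳ.internal hk hx, map_zero,
        gradeProj_of_mem_ne ℳ.internal (by simpa using hk) (ha _ _ hx)]
  have e1 : gradeProj ℳ.internal h ∘ₗ (X * a) ∘ₗ (ℳ.eigen h).subtype = X' ∘ₗ a' := rfl
  have e2 : gradeProj ℳ.internal (h + δ) ∘ₗ (a * X) ∘ₗ (ℳ.eigen (h + δ)).subtype = a' ∘ₗ X' := by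
    ext w
    exact congrArg Subtype.val (key (X w))
  change LinearMap.trace ℂ _ _ = LinearMap.trace ℂ _ _
  rw [e1, e2]
  exact LinearMap.trace_comp_comm' a' X'

lemma σ_mul_σ : ℳ.σ * ℳ.σ = 1 := LinearMap.ext ℳ.σ_σ

lemma σ_mem_eigen (h : ℂ) (w : M) (hw : w ∈ ℳ.eigen h) : ℳ.σ w ∈ ℳ.eigen (h + 0) := by
  rw [add_zero]
  rw [mem_eigen] at hw ⊢
  have := ℳ.σ_mode 𝒱.hasParity_ω 1 w
  rwa [paritySign_zero, one_smul, hw, map_smul, eq_comm] at this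

/-- Cyclicity with respect to `σ` gives `Tr (σ X) = Tr (X σ)`, which is `-Tr (σ X)`. -/
lemma strAt_eq_zero_of_odd {X : Module.End ℂ M} (hX : ℳ.σ * X = -(X * ℳ.σ)) (h : ℂ) :
    ℳ.strAt X h = 0 := by
  have h1 := ℳ.trAt_mul_comm ℳ.σ_mem_eigen (ℳ.σ * X * ℳ.σ) h
  rw [mul_assoc _ ℳ.σ ℳ.σ, σ_mul_σ, mul_one, add_zero, mul_assoc, ← mul_assoc ℳ.σ ℳ.σ, σ_mul_σ,
    one_mul, ← neg_eq_iff_eq_neg.mpr hX, map_neg] at h1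
  rw [strAt_eq]
  linear_combination h1 / 2

variable {ℳ} {g : 𝒱.Automorphism} (gM : ℳ.Lift g)

/-- The operator of a lift. -/
abbrev Lift.op : Module.End ℂ M := gM.toEquiv.toLinearMap

lemma Lift.σ_mul_op : ℳ.σ * gM.op = gM.op * ℳ.σ := LinearMap.ext fun w => (gM.map_σ w).symm

lemma Lift.degMode_mul_op {v : V} {θ : ℂ} {wt d₀ : ℝ} (hθ : θ ≠ 0) (hv : v ∈ 𝒱.weightSpace wt)
    {k : ℤ} (hk : wt = d₀ + k + 1) (hgv : g.toEquiv v = θ⁻¹ • v) :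
    ℳ.degMode v d₀ * gM.op = θ • (gM.op * ℳ.degMode v d₀) := by
  rw [ℳ.degMode_of_mem hv hk]
  ext w
  have := gM.map_mode v w k
  rw [hgv, map_smul] at this
  simp only [Module.End.mul_apply, LinearMap.smul_apply, LinearEquiv.coe_coe, this, Pi.smul_apply,
    smul_smul, mul_inv_cancel₀ hθ, one_smul]

lemma σ_prod_degMode {n : ℕ} {u : Fin n → V} {p : Fin n → ZMod 2}
    (hp : ∀ i, 𝒱.HasParity (p i) (u i)) (d : Fin n → ℝ) :
    ℳ.σ * (List.ofFn fun i => ℳ.degMode (u i) (d i)).prod =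
      paritySign (∑ i, p i) • ((List.ofFn fun i => ℳ.degMode (u i) (d i)).prod * ℳ.σ) := by
  induction n with
  | zero => simp [paritySign_zero]
  | succ n ih =>
    rw [List.ofFn_succ, List.prod_cons, ← mul_assoc, ℳ.σ_degMode (hp 0), smul_mul_assoc, mul_assoc,
      ih (fun i => hp i.succ), Fin.sum_univ_succ, paritySign_add, mul_smul, mul_smul_comm,
      mul_assoc]

/-- The last term is the one in which `v` has passed all factors: cyclicity returns it to the front,
through `σ` with its parity sign and through `g` with the factor `θ`, and raises `h` by `d₀`. -/
lemma Lift.strAt_recursion {v : V} {θ : ℂ} {wt d₀ : ℝ} (hθ : θ ≠ 0) (hv : v ∈ 𝒱.weightSpace wt)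
    {pv : ZMod 2} (hpv : 𝒱.HasParity pv v) {k : ℤ} (hk : wt = d₀ + k + 1)
    (hgv : g.toEquiv v = θ⁻¹ • v) {n : ℕ} {u : Fin n → V} {p : Fin n → ZMod 2}
    (hp : ∀ i, 𝒱.HasParity (p i) (u i)) (d : Fin n → ℝ) (h : ℂ) :
    let B := fun i => ℳ.degMode (u i) (d i)
    ℳ.strAt (gM.op * (ℳ.degMode v d₀ * (List.ofFn B).prod)) h =
      ∑ r, paritySign (pv * ∑ i with i < r, p i) *
        ℳ.strAt (gM.op * (List.ofFn (Function.update B r (ℳ.degMode v d₀ * B r -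
          paritySign (pv * p r) • (B r * ℳ.degMode v d₀)))).prod) h +
      θ * ℳ.strAt (gM.op * (ℳ.degMode v d₀ * (List.ofFn B).prod)) (h + d₀) := by
  intro B
  set a := ℳ.degMode v d₀ with ha
  set P := (List.ofFn B).prod with hP
  have hs := mul_prod_ofFn a B (fun r => a * B r - paritySign (pv * p r) • (B r * a))
    (fun r => paritySign (pv * p r)) (fun _ => rfl)
  conv_lhs => rw [hs]
  simp only [paritySign_mul_sum]
  simp only [mul_add, Finset.mul_sum, mul_smul_comm, ← strAtₗ_apply, map_add, map_sum, map_smul,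
    smul_eq_mul]
  congr 1
  rw [← paritySign_mul_sum]
  simp only [strAtₗ_apply, strAt_eq]
  have hdeg : ∀ h, ∀ w ∈ ℳ.eigen h, a w ∈ ℳ.eigen (h + (d₀ : ℂ)) := by
    intro h w hw
    rw [ha, ℳ.degMode_of_mem hv hk]
    have := ℳ.mode_mem_eigen hpv hv k hw
    rwa [show (wt : ℂ) - k - 1 = d₀ by rw [hk]; push_cast; ring] at this
  have hσa : a * ℳ.σ = paritySign pv • (ℳ.σ * a) := by
    rw [ℳ.σ_degMode hpv, smul_smul, paritySign_mul_self, one_smul]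
  have hcyc : ℳ.trAt h (ℳ.σ * (gM.op * (P * a))) =
      paritySign pv * (θ * ℳ.trAt (h + d₀) (ℳ.σ * (gM.op * (a * P)))) := by
    rw [← mul_assoc, ← mul_assoc, trAt_mul_comm ℳ hdeg, ← mul_assoc, ← mul_assoc, hσa,
      smul_mul_assoc, smul_mul_assoc, mul_assoc ℳ.σ, gM.degMode_mul_op hθ hv hk hgv,
      mul_smul_comm, smul_mul_assoc, map_smul, map_smul, smul_eq_mul, smul_eq_mul]
    simp only [mul_assoc, ha]
  rw [hcyc, ← mul_assoc, ← paritySign_add]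
  -- The accumulated sign is trivial unless `v` is odd and the product of the `u i` is even. Then
  -- the whole operator is odd and its supertrace vanishes, so the sign never matters.
  have h01 : ∀ x y : ZMod 2, x * y + x = 0 ∨ x + y = 1 := by decide
  rcases h01 pv (∑ i, p i) with h0 | h1
  · rw [h0, paritySign_zero, one_mul]
  · have : ℳ.strAt (gM.op * (a * P)) (h + d₀) = 0 := by
      apply ℳ.strAt_eq_zero_of_odd
      rw [← mul_assoc, gM.σ_mul_op, mul_assoc, ← mul_assoc ℳ.σ, ℳ.σ_degMode hpv, smul_mul_assoc,
        mul_assoc, σ_prod_degMode hp, mul_smul_comm, mul_smul_comm, mul_smul_comm, smul_smul, ← paritySign_add, h1,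
        paritySign_one, neg_one_smul]
      simp only [mul_assoc, ha, hP, B]
    rw [strAt_eq] at this
    rw [this, mul_zero, mul_zero]

end VOSAModule

/-! ### Coefficients of n-point functions and the formal recursion -/

lemma hasSum_prod_mul {ι κ : Type*} {f : ι → ℂ} {g : κ → ℂ} {a b : ℂ} (hf : HasSum f a)
    (hg : HasSum g b) : HasSum (fun x : ι × κ => f x.1 * g x.2) (a * b) :=
  hf.mul hg (summable_mul_of_summable_norm (f := f) (g := g) hf.summable.norm hg.summable.norm)

namespace VOSAModule

variable {V : Type*} [AddCommGroup V] [Module ℂ V] {𝒱 : VOSA V}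
  {M : Type*} [AddCommGroup M] [Module ℂ M] {ℳ : VOSAModule 𝒱 M}
  {g : 𝒱.Automorphism} (gM : ℳ.Lift g)

lemma degMode_update {n : ℕ} (u : Fin n → V) (d : Fin n → ℝ) (r : Fin n) (x : V) (y : ℝ) :
    (fun i => ℳ.degMode (Function.update u r x i) (Function.update d r y i)) =
      Function.update (fun i => ℳ.degMode (u i) (d i)) r (ℳ.degMode x y) := by
  funext i
  by_cases hi : i = r
  · subst hi; simp
  · simp [Function.update_of_ne hi]

/-- `strAt` of a lift times a product, as a multilinear map of the factors. -/
def Lift.strAtProd (h : ℂ) (n : ℕ) : MultilinearMap ℂ (fun _ : Fin n => Module.End ℂ M) ℂ :=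
  (ℳ.strAtₗ h ∘ₗ LinearMap.mulLeft ℂ gM.op).compMultilinearMap
    (MultilinearMap.mkPiAlgebraFin ℂ n (Module.End ℂ M))

lemma Lift.strAtProd_apply (h : ℂ) {n : ℕ} (B : Fin n → Module.End ℂ M) :
    gM.strAtProd h n B = ℳ.strAt (gM.op * (List.ofFn B).prod) h := by
  simp [strAtProd, strAtₗ_apply]

lemma Lift.coeff_one_update (h : ℂ) {n : ℕ} (u : Fin n → V) (d : Fin n → ℝ) (r : Fin n) (x : V)
    (y : ℝ) : gM.coeff 1 (Function.update u r x) (Function.update d r y) h =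
      gM.strAtProd h n (Function.update (fun i => ℳ.degMode (u i) (d i)) r (ℳ.degMode x y)) := by
  rw [coeff, degMode_update, strAtProd_apply, mul_one]

lemma Lift.coeff_eq_zero {h : ℂ} (hh : ℳ.eigen h = ⊥) (A : Module.End ℂ M) {n : ℕ} (u : Fin n → V)
    (d : Fin n → ℝ) : gM.coeff A u d h = 0 := ℳ.strAt_eq_zero hh _

lemma Lift.coeff_cons (h : ℂ) {n : ℕ} (v : V) (u : Fin n → V) (d₀ : ℝ) (d : Fin n → ℝ) :
    gM.coeff 1 (Fin.cons v u : Fin (n + 1) → V) (Fin.cons d₀ d) h =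
      ℳ.strAt (gM.op * (ℳ.degMode v d₀ * (List.ofFn fun i => ℳ.degMode (u i) (d i)).prod)) h := by
  rw [coeff, List.ofFn_succ, List.prod_cons, mul_one]
  rfl

variable (ℳ) in
lemma exists_eigen_eq_bot (h : ℂ) (d : ℝ) : ∃ J : ℕ, 1 ≤ J ∧
    (d ≠ 0 → ∀ j : ℕ, J ≤ j + 1 → ℳ.eigen (h - |d| * j) = ⊥) := by
  obtain ⟨x₀, hx₀⟩ := ℳ.bounded_below h
  obtain ⟨N, hN⟩ := exists_nat_gt (-x₀ / |d|)
  refine ⟨N + 1, by omega, fun hd j hj => ?_⟩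
  have hd' : 0 < |d| := abs_pos.mpr hd
  rw [div_lt_iff₀ hd'] at hN
  have hj' : (N : ℝ) ≤ j := by exact_mod_cast (show N ≤ j by omega)
  have := hx₀ (-(|d| * j)) (by nlinarith)
  rw [sub_eq_add_neg]
  push_cast at this
  exact this

lemma Lift.coeff_cons_eq_sum {v : V} {θ : ℂ} {wt d₀ : ℝ} (hθ : θ ≠ 0) (hv : v ∈ 𝒱.weightSpace wt)
    {pv : ZMod 2} (hpv : 𝒱.HasParity pv v) {k : ℤ} (hk : wt = d₀ + k + 1)
    (hgv : g.toEquiv v = θ⁻¹ • v) {n : ℕ} {u : Fin n → V} {p : Fin n → ZMod 2}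
    (hp : ∀ i, 𝒱.HasParity (p i) (u i)) (d : Fin n → ℝ) (h : ℂ) {J : ℕ} (hJ1 : 1 ≤ J)
    (hJ : d₀ ≠ 0 → ∀ j : ℕ, J ≤ j + 1 → ℳ.eigen (h - |d₀| * j) = ⊥) :
    ∀ᶠ K in Filter.atTop, gM.coeff 1 (Fin.cons v u : Fin (n + 1) → V) (Fin.cons d₀ d) h =
      (if θ = 1 ∧ d₀ = 0 then gM.coeff 1 (Fin.cons v u : Fin (n + 1) → V) (Fin.cons d₀ d) h else 0) -
      ∑ j ∈ Finset.range J, outerCoeff θ d₀ j * ∑ r, paritySign (pv * ∑ i with i < r, p i) *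
        ∑ m ∈ Finset.range K, ((-d₀ : ℂ) ^ m / (m.factorial : ℂ)) *
          gM.coeff 1 (Function.update u r (𝒱.sqMode wt v m (u r)))
            (Function.update d r (d r + d₀)) (h - |d₀| * j) := by
  have hcomm := fun r => ℳ.degMode_commutator_sqMode hv hpv (hp r) hk (d r)
  rw [← Filter.eventually_all] at hcomm
  filter_upwards [hcomm] with K hK
  refine solve_recursion (T := fun h => gM.coeff 1 (Fin.cons v u : Fin (n + 1) → V) (Fin.cons d₀ d) h)
    (R := fun h => ∑ r, paritySign (pv * ∑ i with i < r, p i) *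
        ∑ m ∈ Finset.range K, ((-d₀ : ℂ) ^ m / (m.factorial : ℂ)) *
          gM.coeff 1 (Function.update u r (𝒱.sqMode wt v m (u r)))
            (Function.update d r (d r + d₀)) h) hθ (fun h => ?_) h hJ1
    (fun hd j hj => gM.coeff_eq_zero (hJ hd j hj) _ _ _)
  simp only [coeff_cons]
  rw [gM.strAt_recursion hθ hv hpv hk hgv hp d h]
  congr 1
  refine Finset.sum_congr rfl fun r _ => ?_
  congr 1
  rw [hK r, ← strAtProd_apply, MultilinearMap.map_update_sum]
  refine Finset.sum_congr rfl fun m _ => ?_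
  rw [MultilinearMap.map_update_smul, coeff_one_update, smul_eq_mul]

/-- For `d₀ ≠ 0` the weights `h - |d₀| j` eventually leave the spectrum; for `d₀ = 0` the expansion
coefficient itself vanishes for `j ≠ 0`. -/
lemma finite_support_coeff {θ φ : ℂ} (m : ℕ) (d₀ : ℝ) (h : ℂ) {J : ℕ} (hJ1 : 1 ≤ J)
    (hJ : d₀ ≠ 0 → ∀ j : ℕ, J ≤ j + 1 → ℳ.eigen (h - |d₀| * j) = ⊥) {n : ℕ} (u : Fin n → V)
    (d : Fin n → ℝ) :
    (Function.support fun j : ℕ => twistedPCoeff (m + 1) θ φ d₀ j * gM.coeff 1 u d (h - |d₀| * j)) ⊆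
      Finset.range J := by
  intro j hj
  by_contra hjJ
  simp only [Finset.coe_range, Set.mem_Iio, not_lt] at hjJ
  apply hj
  beta_reduce
  by_cases hd : d₀ = 0
  · subst hd
    have : j ≠ 0 := by omega
    simp [twistedPCoeff, this]
  · rw [gM.coeff_eq_zero (hJ hd j (by omega)), mul_zero]

lemma Lift.coeff_formal_recursion {v : V} {θ φ : ℂ} {wt : ℝ} (hθ : θ ≠ 0)
    (hv : v ∈ 𝒱.weightSpace wt) {pv : ZMod 2} (hpv : 𝒱.HasParity pv v)
    (hgv : g.toEquiv v = θ⁻¹ • v) (hφ : φ = Complex.exp (2 * Real.pi * Complex.I * wt))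
    {n : ℕ} {u : Fin n → V} {p : Fin n → ZMod 2}
    (hp : ∀ i, 𝒱.HasParity (p i) (u i)) (d₀ : ℝ) (d : Fin n → ℝ) (h : ℂ) :
    gM.coeff 1 (Fin.cons v u : Fin (n + 1) → V) (Fin.cons d₀ d) h =
      (if θ = 1 ∧ φ = 1 ∧ d₀ = 0 then gM.coeff (ℳ.zeroMode v) u d h else 0) +
      ∑ r : Fin n, ∑ᶠ m : ℕ, paritySign (pv * ∑ i ∈ Finset.univ.filter (· < r), p i) *
        ∑ᶠ j : ℕ, twistedPCoeff (m + 1) θ φ d₀ j *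
          gM.coeff 1 (Function.update u r (𝒱.sqMode wt v m (u r)))
            (Function.update d r (d r + d₀)) (h - |d₀| * j) := by
  have hzm : d₀ = 0 → gM.coeff (ℳ.zeroMode v) u d h =
      gM.coeff 1 (Fin.cons v u : Fin (n + 1) → V) (Fin.cons d₀ d) h := by
    rintro rfl
    rw [coeff_cons, coeff, zeroMode, mul_assoc]
  -- The exponents allowed in the Weierstrass expansion are exactly the degrees in which `v` has a
  -- mode; for all other `d₀` both sides of the recursion are zero.
  have hiff : Complex.exp (2 * Real.pi * Complex.I * d₀) = φ ↔ ∃ k : ℤ, wt = d₀ + k + 1 := by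
    rw [hφ, eq_comm, Complex.exp_eq_exp_iff_exists_int]
    have h0 : (2 * Real.pi * Complex.I : ℂ) ≠ 0 := Complex.two_pi_I_ne_zero
    constructor
    · rintro ⟨k, hk⟩
      refine ⟨k - 1, ?_⟩
      have : (2 * Real.pi * Complex.I : ℂ) * wt = 2 * Real.pi * Complex.I * ((d₀ + k : ℝ) : ℂ) := by
        rw [hk]; push_cast; ring
      have := mul_left_cancel₀ h0 this
      rw [Complex.ofReal_inj] at this
      rw [this]; push_cast; ring
    · rintro ⟨k, hk⟩
      exact ⟨k + 1, by rw [hk]; push_cast; ring⟩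
  by_cases hk : ∃ k : ℤ, wt = d₀ + k + 1
  · have hφd := hiff.mpr hk
    obtain ⟨k, hk⟩ := hk
    obtain ⟨J, hJ1, hJ⟩ := ℳ.exists_eigen_eq_bot h d₀
    choose N hN using fun r => 𝒱.exists_truncation v (u r)
    obtain ⟨K, hK, hKN⟩ := ((gM.coeff_cons_eq_sum hθ hv hpv hk hgv hp d h hJ1 hJ).and
      (Filter.eventually_all.mpr fun r => Filter.eventually_ge_atTop (N r))).exists
    rw [hK]
    rw [sub_eq_add_neg]
    congr 1
    · by_cases hd : d₀ = 0
      · rw [hzm hd]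
        have : φ = 1 := by rw [← hφd, hd]; simp
        simp [this]
      · simp [hd]
    · rw [← Finset.sum_neg_distrib]
      simp only [Finset.mul_sum, ← Finset.sum_neg_distrib]
      rw [Finset.sum_comm]
      refine Finset.sum_congr rfl fun r _ => ?_
      rw [finsum_eq_sum_of_support_subset (s := Finset.range K), Finset.sum_comm]
      · refine Finset.sum_congr rfl fun m _ => ?_
        rw [finsum_eq_sum_of_support_subset _ (finite_support_coeff gM m d₀ h hJ1 hJ _ _),
          Finset.mul_sum]
        refine Finset.sum_congr rfl fun j _ => ?_
        rw [twistedPCoeff, if_pos hφd]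
        change _ = _ * ((_ * _ * outerCoeff θ d₀ j) * _)
        -- The minus sign from `solve_recursion` and `(-d₀)^m / m!` combine to the prefactor
        -- `(-1)^(m+1) / m! · d₀^m` of `P_{m+1}`.
        rw [Nat.add_sub_cancel, pow_succ, neg_pow (d₀ : ℂ)]
        ring
      · intro m hm
        by_contra hmK
        simp only [Finset.coe_range, Set.mem_Iio, not_lt] at hmK
        apply hm
        have : 𝒱.sqMode wt v m (u r) = 0 :=
          𝒱.sqMode_eq_zero wt v (u r) (hN r) ((hKN r).trans hmK)
        have h0 : ∀ h', gM.coeff 1 (Function.update u r (𝒱.sqMode wt v m (u r)))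
            (Function.update d r (d r + d₀)) h' = 0 := fun h' => by
          rw [coeff_one_update, this, ← degModeₗ_apply, map_zero]
          exact MultilinearMap.map_update_zero _ _ _
        simp only [h0, mul_zero, finsum_zero]
  · have hφd := mt hiff.mp hk
    push Not at hk
    have h1 : gM.coeff 1 (Fin.cons v u : Fin (n + 1) → V) (Fin.cons d₀ d) h = 0 := by
      rw [coeff_cons, ℳ.degMode_of_mem_ne hv hk, zero_mul, mul_zero, ← strAtₗ_apply, map_zero]
    have h2 : (if θ = 1 ∧ φ = 1 ∧ d₀ = 0 then gM.coeff (ℳ.zeroMode v) u d h else 0) = 0 := by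
      split_ifs with hd
      · rw [hzm hd.2.2, h1]
      · rfl
    have h3 : ∀ m j, twistedPCoeff (m + 1) θ φ d₀ j = 0 := fun m j => if_neg hφd
    simp only [h1, h2, h3, zero_mul, finsum_zero, mul_zero, Finset.sum_const_zero, add_zero]

/-! ### From formal series to convergent functions -/

/-- Reindexing of the product of the expansion of a twisted Weierstrass function in `z - ζ r` with
an `n`-point series. -/
def reindex {n : ℕ} (r : Fin n) :
    ((Fin (n + 1) → ℝ) × ℂ) × ℕ ≃ (ℝ × ℕ) × ((Fin n → ℝ) × ℂ) where
  toFun x := ((x.1.1 0, x.2), (Function.update (Fin.tail x.1.1) r (Fin.tail x.1.1 r + x.1.1 0),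
    x.1.2 - |x.1.1 0| * x.2))
  invFun y := (((Fin.cons y.1.1 (Function.update y.2.1 r (y.2.1 r - y.1.1)) : Fin (n + 1) → ℝ),
    y.2.2 + |y.1.1| * y.1.2), y.1.2)
  left_inv := by
    rintro ⟨⟨D, h⟩, j⟩
    simp
  right_inv := by
    rintro ⟨⟨x, j⟩, ⟨d, h⟩⟩
    simp

/-- The product of the two absolutely convergent series is summed along the fibres of total exponent
`(D, h)`. Such a fibre is parametrised by `j` and has finitely many nonzero terms, so its sum is the
finite sum of the formal recursion. -/
lemma Lift.hasSum_recursion_term {θ φ : ℂ} {n : ℕ} (r : Fin n) (m : ℕ) (u : Fin n → V)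
    {z τ P : ℂ} {ζ : Fin n → ℂ}
    (hP : HasSum (fun s : ℝ × ℕ => twistedPCoeff (m + 1) θ φ s.1 s.2 *
      Complex.exp (s.1 * (z - ζ r)) *
        Complex.exp (2 * Real.pi * Complex.I * τ * (|s.1| * s.2))) P)
    (hS : Summable (gM.term 1 u ζ τ)) :
    HasSum (fun q : (Fin (n + 1) → ℝ) × ℂ => (∑ᶠ j : ℕ, twistedPCoeff (m + 1) θ φ (q.1 0) j *
        gM.coeff 1 u (Function.update (Fin.tail q.1) r (Fin.tail q.1 r + q.1 0))
          (q.2 - |q.1 0| * j)) *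
        Complex.exp (∑ i, (q.1 i : ℂ) * (Fin.cons z ζ : Fin (n + 1) → ℂ) i) *
        Complex.exp (2 * Real.pi * Complex.I * τ * (q.2 - 𝒱.c / 24)))
      (P * gM.nPoint u ζ τ) := by
  have hprod := hasSum_prod_mul hP hS.hasSum
  refine ((reindex r).hasSum_iff.mpr hprod).prod_fiberwise ?_
  rintro ⟨D, h⟩
  obtain ⟨J, hJ1, hJ⟩ := ℳ.exists_eigen_eq_bot h (D 0)
  have hsub := finite_support_coeff gM (θ := θ) (φ := φ) m (D 0) h hJ1 hJ u
    (Function.update (Fin.tail D) r (Fin.tail D r + D 0))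
  have hj : HasSum (fun j : ℕ => twistedPCoeff (m + 1) θ φ (D 0) j *
        gM.coeff 1 u (Function.update (Fin.tail D) r (Fin.tail D r + D 0)) (h - |D 0| * j))
      (∑ᶠ j : ℕ, twistedPCoeff (m + 1) θ φ (D 0) j *
        gM.coeff 1 u (Function.update (Fin.tail D) r (Fin.tail D r + D 0)) (h - |D 0| * j)) := by
    rw [finsum_eq_sum_of_support_subset _ hsub]
    exact hasSum_sum_of_ne_finset_zero fun j hj => by
      by_contra h'
      exact hj (hsub h')
  refine ((hj.mul_right (Complex.exp (∑ i, (D i : ℂ) * (Fin.cons z ζ : Fin (n + 1) → ℂ) i))).mul_right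
    (Complex.exp (2 * Real.pi * Complex.I * τ * (h - 𝒱.c / 24)))).congr_terms fun j => ?_
  -- The factor `e^{-D₀ ζ_r}` offsets the raised exponent of `q_r`, and `q^{|D₀| j}` offsets the
  -- lowered weight.
  have hexp : Complex.exp (D 0 * (z - ζ r)) *
      Complex.exp (2 * Real.pi * Complex.I * τ * (|D 0| * j)) *
      (Complex.exp (∑ i, ((Function.update (Fin.tail D) r (Fin.tail D r + D 0) i : ℝ) : ℂ) * ζ i) *
        Complex.exp (2 * Real.pi * Complex.I * τ * (h - |D 0| * j - 𝒱.c / 24))) =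
      Complex.exp (∑ i, (D i : ℂ) * (Fin.cons z ζ : Fin (n + 1) → ℂ) i) *
        Complex.exp (2 * Real.pi * Complex.I * τ * (h - 𝒱.c / 24)) := by
    have hsum : ∑ i, ((Function.update (Fin.tail D) r (Fin.tail D r + D 0) i : ℝ) : ℂ) * ζ i =
        ∑ i : Fin n, (D i.succ : ℂ) * ζ i + D 0 * ζ r := by
      have : ∀ i, ((Function.update (Fin.tail D) r (Fin.tail D r + D 0) i : ℝ) : ℂ) * ζ i =
          (D i.succ : ℂ) * ζ i + if i = r then (D 0 : ℂ) * ζ r else 0 := by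
        intro i
        by_cases hi : i = r
        · subst hi; simp [Fin.tail]; ring
        · simp [hi, Fin.tail]
      simp [this, Finset.sum_add_distrib]
    rw [hsum, Fin.sum_univ_succ, Fin.cons_zero]
    simp only [Fin.cons_succ, ← Complex.exp_add]
    congr 1
    ring
  rw [mul_assoc _ (Complex.exp _) (Complex.exp _), ← hexp]
  simp only [Function.comp, reindex, Equiv.coe_fn_mk, term]
  ring

lemma Lift.hasSum_zeroMode_term {θ φ : ℂ} {n : ℕ} (v : V) (u : Fin n → V) {z τ : ℂ} {ζ : Fin n → ℂ}
    (hS : θ = 1 → φ = 1 → Summable (gM.term (ℳ.zeroMode v) u ζ τ)) :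
    HasSum (fun q : (Fin (n + 1) → ℝ) × ℂ =>
        (if θ = 1 ∧ φ = 1 ∧ q.1 0 = 0 then gM.coeff (ℳ.zeroMode v) u (Fin.tail q.1) q.2 else 0) *
        Complex.exp (∑ i, (q.1 i : ℂ) * (Fin.cons z ζ : Fin (n + 1) → ℂ) i) *
        Complex.exp (2 * Real.pi * Complex.I * τ * (q.2 - 𝒱.c / 24)))
      (if θ = 1 ∧ φ = 1 then gM.str (ℳ.zeroMode v) u ζ τ else 0) := by
  by_cases hc : θ = 1 ∧ φ = 1
  · rw [if_pos hc]
    have hinj : Function.Injective fun q : (Fin n → ℝ) × ℂ =>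
        ((Fin.cons 0 q.1 : Fin (n + 1) → ℝ), q.2) := by
      rintro ⟨a, b⟩ ⟨a', b'⟩ hab
      simpa using hab
    refine (hinj.hasSum_iff ?_).mp ((hS hc.1 hc.2).hasSum.congr_terms ?_)
    · rintro ⟨D, h⟩ hq
      rw [if_neg, zero_mul, zero_mul]
      rintro ⟨-, -, hD⟩
      refine hq ⟨(Fin.tail D, h), ?_⟩
      have := Fin.cons_self_tail D
      rw [show D 0 = 0 from hD] at this
      exact Prod.ext this rfl
    · rintro ⟨d, h⟩
      simp [hc.1, hc.2, term, Fin.sum_univ_succ]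
  · rw [if_neg hc]
    convert hasSum_zero with q
    rw [if_neg (by tauto), zero_mul, zero_mul]

end VOSAModule

end

/-! ### The recursion formula -/

theorem theorem3 {V M : Type*} [AddCommGroup V] [Module ℂ V] [AddCommGroup M] [Module ℂ M]
    (𝒱 : VOSA V) (ℳ : VOSAModule 𝒱 M) (g : 𝒱.Automorphism) (gM : ℳ.Lift g)
    (v : V) (wt : ℝ) (hv : v ∈ 𝒱.weightSpace wt) (pv : ZMod 2) (hpv : 𝒱.HasParity pv v)
    (θ φ : ℂ) (hθ : ‖θ‖ = 1) (hgv : g.toEquiv v = θ⁻¹ • v)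
    (hφ : φ = Complex.exp (2 * Real.pi * Complex.I * wt))
    (n : ℕ) (u : Fin n → V) (p : Fin n → ZMod 2) (hp : ∀ i, 𝒱.HasParity (p i) (u i)) :
    -- the recursion for convergent n-point functions
    (∀ (τ z : ℂ) (ζ : Fin n → ℂ), 0 < τ.im →
      (∀ r, ‖nome τ‖ < ‖Complex.exp (ζ r - z)‖ ∧ ‖Complex.exp (ζ r - z)‖ < 1) →
      (∀ (r : Fin n) (m : ℕ),
        Summable (gM.term 1 (Function.update u r (𝒱.sqMode wt v m (u r))) ζ τ)) →
      (θ = 1 → φ = 1 → Summable (gM.term (ℳ.zeroMode v) u ζ τ)) →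
      Summable (gM.term 1 (Fin.cons v u : Fin (n + 1) → V) (Fin.cons z ζ) τ) ∧
      gM.nPoint (Fin.cons v u : Fin (n + 1) → V) (Fin.cons z ζ) τ =
        (if θ = 1 ∧ φ = 1 then gM.str (ℳ.zeroMode v) u ζ τ else 0) +
        ∑ r : Fin n, ∑ᶠ m : ℕ, paritySign (pv * ∑ i ∈ Finset.univ.filter (· < r), p i) *
          twistedP (m + 1) θ φ (z - ζ r) τ *
          gM.nPoint (Function.update u r (𝒱.sqMode wt v m (u r))) ζ τ) ∧
    -- the recursion between formal series, without any convergence assumption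
    (∀ (d₀ : ℝ) (d : Fin n → ℝ) (h : ℂ),
      gM.coeff 1 (Fin.cons v u : Fin (n + 1) → V) (Fin.cons d₀ d) h =
        (if θ = 1 ∧ φ = 1 ∧ d₀ = 0 then gM.coeff (ℳ.zeroMode v) u d h else 0) +
        ∑ r : Fin n, ∑ᶠ m : ℕ, paritySign (pv * ∑ i ∈ Finset.univ.filter (· < r), p i) *
          ∑ᶠ j : ℕ, twistedPCoeff (m + 1) θ φ d₀ j *
            gM.coeff 1 (Function.update u r (𝒱.sqMode wt v m (u r)))
              (Function.update d r (d r + d₀)) (h - |d₀| * j)) ∧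
    -- the formal series used there are the expansions of the twisted Weierstrass functions
    (∀ (k : ℕ) (τ z : ℂ), 1 ≤ k → 0 < τ.im → 1 < ‖Complex.exp z‖ →
      ‖nome τ‖ * ‖Complex.exp z‖ < 1 →
      HasSum (fun s : ℝ × ℕ => twistedPCoeff k θ φ s.1 s.2 * Complex.exp (s.1 * z) *
        Complex.exp (2 * Real.pi * Complex.I * τ * (|s.1| * s.2)))
        (twistedP k θ φ z τ)) := by
  have hθ0 : θ ≠ 0 := by rintro rfl; simp at hθ
  have hφ1 : ‖φ‖ = 1 := by
    rw [hφ, Complex.norm_exp, Real.exp_eq_one_iff]; simp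
  have hformal := gM.coeff_formal_recursion hθ0 hv hpv hgv hφ hp
  refine ⟨fun τ z ζ hτ hζ hsum hsum0 => ?_, hformal, fun k τ z _ hτ hz hz' =>
    hasSum_twistedPCoeff k hθ hφ1 hτ hz hz'⟩
  have hP : ∀ (r : Fin n) (m : ℕ), HasSum (fun s : ℝ × ℕ => twistedPCoeff (m + 1) θ φ s.1 s.2 *
      Complex.exp (s.1 * (z - ζ r)) * Complex.exp (2 * Real.pi * Complex.I * τ * (|s.1| * s.2)))
      (twistedP (m + 1) θ φ (z - ζ r) τ) := by
    intro r m
    obtain ⟨h1, h2⟩ := hζ r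
    have e : Complex.exp (ζ r - z) = (Complex.exp (z - ζ r))⁻¹ := by
      rw [← Complex.exp_neg, neg_sub]
    have hpos : 0 < ‖Complex.exp (z - ζ r)‖ := norm_pos_iff.mpr (Complex.exp_ne_zero _)
    rw [e, norm_inv] at h1 h2
    refine hasSum_twistedPCoeff (m + 1) hθ hφ1 hτ ((inv_lt_one₀ hpos).mp h2) ?_
    rwa [lt_inv_comm₀ (by rw [norm_nome]; exact Real.exp_pos _) hpos, ← one_div,
      lt_div_iff₀ (by rw [norm_nome]; exact Real.exp_pos _), mul_comm] at h1
  choose N hN using fun r => 𝒱.exists_truncation v (u r)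
  -- A truncation bound common to all insertions: `v[m] (u r) = 0` for `m ≥ K`, so the sums over `m`
  -- become finite.
  set K := Finset.univ.sup N with hK
  have hsq : ∀ (r : Fin n) (m : ℕ), K ≤ m → 𝒱.sqMode wt v m (u r) = 0 := fun r m hm =>
    𝒱.sqMode_eq_zero wt v (u r) (hN r) ((Finset.le_sup (Finset.mem_univ r)).trans hm)
  have hcoeff0 : ∀ (r : Fin n) (m : ℕ), K ≤ m → ∀ d h,
      gM.coeff 1 (Function.update u r (𝒱.sqMode wt v m (u r))) d h = 0 := by
    intro r m hm d h
    rw [hsq r m hm, ← Function.update_eq_self r d, gM.coeff_one_update, ← ℳ.degModeₗ_apply, map_zero]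
    exact MultilinearMap.map_update_zero _ _ _
  -- Everything on the right is now one convergent series over the exponents of the left side. By
  -- the formal recursion its terms are those of the left series, which gives summability and the
  -- value together.
  have htot := (gM.hasSum_zeroMode_term (z := z) v u hsum0).add
    (hasSum_sum (s := Finset.univ) fun r _ => hasSum_sum (s := Finset.range K) fun m _ =>
      (gM.hasSum_recursion_term r m _ (hP r m) (hsum r m)).mul_left
        (paritySign (pv * ∑ i ∈ Finset.univ.filter (· < r), p i)))
  have hmain : HasSum (gM.term 1 (Fin.cons v u : Fin (n + 1) → V) (Fin.cons z ζ) τ)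
      ((if θ = 1 ∧ φ = 1 then gM.str (ℳ.zeroMode v) u ζ τ else 0) +
        ∑ r : Fin n, ∑ᶠ m : ℕ, paritySign (pv * ∑ i ∈ Finset.univ.filter (· < r), p i) *
          twistedP (m + 1) θ φ (z - ζ r) τ *
          gM.nPoint (Function.update u r (𝒱.sqMode wt v m (u r))) ζ τ) := by
    have e : ∀ r : Fin n, ∑ᶠ m : ℕ, paritySign (pv * ∑ i ∈ Finset.univ.filter (· < r), p i) *
          twistedP (m + 1) θ φ (z - ζ r) τ *
          gM.nPoint (Function.update u r (𝒱.sqMode wt v m (u r))) ζ τ =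
        ∑ m ∈ Finset.range K, paritySign (pv * ∑ i ∈ Finset.univ.filter (· < r), p i) *
          (twistedP (m + 1) θ φ (z - ζ r) τ *
          gM.nPoint (Function.update u r (𝒱.sqMode wt v m (u r))) ζ τ) := by
      intro r
      rw [finsum_eq_sum_of_support_subset (s := Finset.range K)]
      · simp only [mul_assoc]
      · intro m hm
        by_contra hmK
        simp only [Finset.coe_range, Set.mem_Iio, not_lt] at hmK
        apply hm
        simp [VOSAModule.Lift.nPoint, VOSAModule.Lift.str, VOSAModule.Lift.term, hcoeff0 r m hmK]
    simp only [e]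
    refine htot.congr_terms fun q => ?_
    have hq := hformal (q.1 0) (Fin.tail q.1) q.2
    rw [Fin.cons_self_tail] at hq
    rw [VOSAModule.Lift.term, hq, add_mul, add_mul]
    congr 1
    rw [Finset.sum_mul, Finset.sum_mul]
    refine Finset.sum_congr rfl fun r _ => ?_
    rw [finsum_eq_sum_of_support_subset (s := Finset.range K), Finset.sum_mul, Finset.sum_mul]
    · refine Finset.sum_congr rfl fun m _ => ?_
      ring
    · intro m hm
      by_contra hmK
      simp only [Finset.coe_range, Set.mem_Iio, not_lt] at hmK
      apply hm
      simp only [hcoeff0 r m hmK, mul_zero, finsum_zero]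
  exact ⟨hmain.summable, hmain.tsum_eq⟩
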